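/- Let $n\ge 2$ be an even integer and $s\ge n$ a real number. Let $Q:\mathbb{R}^n\to\mathbb{R}$ be a smooth function satisfying the $s$-cone condition, that is: $Q \in L^\infty_{loc}(\mathbb{R}^n)$; there is a constant $C$ with $|Q(x)|\le C(|x|+1)^s$ for all $x\in\mathbb{R}^n$; and there are $0<r_0<1$, $c_1>0$ and a sequence $(x_i)\subset\mathbb{R}^n$ with $|x_i|\ge 1$ and $|x_i|\to\infty$ such that $|Q(x)|/|x|^s\ge c_1$ for every $i$ and every $x\in B_{r_0|x_i|}(x_i)$. Suppose moreover that $x\cdot\nabla Q(x)\le 0$ for all $x\in\mathbb{R}^n$. Then there is no smooth function $u:\mathbb{R}^n\to\mathbb{R}$ with $Qe^{nu}\in L^1(\mathbb{R}^n)$ that is a normal solution with $Q$-curvature $Q$, i.e. such that, for some constant $C\in\mathbb{R}$, $$u(x)=\frac{2}{(n-1)!\,|\mathbb{S}^n|}\int_{\mathbb{R}^n}\log\frac{|y|}{|x-y|}\,Q(y)e^{nu(y)}\,dy+C\qquad\text{for all }x\in\mathbb{R}^n,$$ where $|\mathbb{S}^n|$ is the volume of the standard unit $n$-sphere. -/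

import Mathlib

open MeasureTheory Filter Topology
open scoped ContDiff Nat ENNReal

/-- The volume `|𝕊ⁿ|` of the standard unit sphere of `ℝⁿ⁺¹`, for its surface measure. -/
noncomputable def sphereVolume (n : ℕ) : ℝ :=
  (volume : Measure (EuclideanSpace ℝ (Fin (n + 1)))).toSphere.real Set.univ

/-- The function `u` is a normal solution with Q-curvature `Q`: for some constant `C`,
`u(x) = 2 / ((n-1)! |𝕊ⁿ|) ∫ log (|y| / |x - y|) Q(y) e^{n u(y)} dy + C` for all `x`.
Used for smooth `Q`, `u` with `Q e^{nu}` integrable, in which case the integral converges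
absolutely for every `x`. -/
def IsNormalSolution (n : ℕ) (Q u : EuclideanSpace ℝ (Fin n) → ℝ) : Prop :=
  ∃ C : ℝ, ∀ x : EuclideanSpace ℝ (Fin n),
    u x = 2 / (((n - 1)! : ℕ) * sphereVolume n) *
      (∫ y, Real.log (‖y‖ / ‖x - y‖) * (Q y * Real.exp (n * u y))) + C

/-- The `s`-cone condition for a function `ψ` in `L^∞_loc(ℝⁿ)`. -/
structure SatisfiesCone {n : ℕ} (s : ℝ) (ψ : EuclideanSpace ℝ (Fin n) → ℝ) : Prop where
  memLp_loc : ∀ K : Set (EuclideanSpace ℝ (Fin n)), IsCompact K →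
    MemLp ψ ∞ (volume.restrict K)
  growth : ∃ C : ℝ, ∀ x, |ψ x| ≤ C * (‖x‖ + 1) ^ s
  cone : ∃ r₀ : ℝ, 0 < r₀ ∧ r₀ < 1 ∧
    ∃ p : ℕ → EuclideanSpace ℝ (Fin n),
      (∀ i, 1 ≤ ‖p i‖) ∧ Tendsto (fun i => ‖p i‖) atTop atTop ∧
      ∃ c₁ : ℝ, 0 < c₁ ∧ ∀ i, ∀ x ∈ Metric.ball (p i) (r₀ * ‖p i‖), c₁ ≤ |ψ x| / ‖x‖ ^ s

/-! ### Integrals of `|x - y|⁻¹` over balls -/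

section RieszKernel

/-! Write `f = Q e^{nu}`, `F = ∫ f` and `b = 2 / ((n-1)! |𝕊ⁿ|)`. Two bounds on the mass `b F` meet
exactly at the value `2`, and the equality case is impossible.

Upper bound (Pohozaev). Multiply the divergence of `η f x` by `u` and integrate by parts, `η` being
a cut-off. Inserting the logarithmic representation of `u` and symmetrising in `(x, y)` turns the
kernel into `(x - y)·(η(x)x - η(y)y) / |x - y|²`, which is bounded and tends to `1` as `η → 1`.
Hence `(n b / 2) F² - n F` is the limit of `∫ η (x·∇Q) e^{nu}`, which is nonpositive
(`tendsto_pohozaev`, `pohozaev_of_fderiv_nonpos`). No decay of `u` is needed, only `f ∈ L¹`.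

Lower bound (cone). The mean of `u` over `B(p, r|p|)` is `-(b F + o(1)) log |p|` along the cone
sequence. By Jensen and `|Q| ≥ c |p|^s` on that ball, `∫ |f|` dominates a multiple of `|p|^{s + n -
n b F - o(1)}`; it is finite, so `s + n ≤ n b F` (`add_finrank_le_of_cone`).

With `s ≥ n` the second bound gives `b F ≥ 2`, so `F > 0` and the first gives `b F ≤ 2`. Equality in
Pohozaev forces `x·∇Q = 0`, so `Q` is constant, against its growth on the cone balls. -/

lemma indicator_ball_inv_norm_sub {E : Type*} [SeminormedAddCommGroup E] (x y : E) (r : ℝ) :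
    (Metric.ball y r).indicator (fun x => ‖x - y‖⁻¹) x =
      (Metric.ball (0 : E) r).indicator (fun z => ‖z‖⁻¹) (x - y) := by
  classical simp [Set.indicator_apply, dist_eq_norm]

/-- Moves the singularity to a ball centred at the pole, whose integral does not depend on the pole;
this is what makes later bounds uniform in `y`. -/
lemma inv_norm_sub_le {E : Type*} [SeminormedAddCommGroup E] (x y : E) {r : ℝ} (hr : 0 < r) :
    ‖x - y‖⁻¹ ≤ r⁻¹ + (Metric.ball y r).indicator (fun x => ‖x - y‖⁻¹) x := by
  by_cases hx : x ∈ Metric.ball y r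
  · simp only [Set.indicator_of_mem hx]
    have : 0 < r⁻¹ := inv_pos.2 hr
    linarith
  · simp only [Set.indicator_of_notMem hx, add_zero]
    have : r ≤ ‖x - y‖ := by simpa [dist_eq_norm] using hx
    exact inv_anti₀ hr this

variable {E : Type*} [NormedAddCommGroup E] [InnerProductSpace ℝ E] [FiniteDimensional ℝ E]
  [MeasurableSpace E] [BorelSpace E]

/-- In polar coordinates the integrand is `t ^ (d - 2)`, with `d` the dimension; this is where `d ≥
2` enters. -/
lemma integrableOn_inv_norm_ball (hE : 2 ≤ Module.finrank ℝ E) (r : ℝ) :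
    IntegrableOn (fun z : E => ‖z‖⁻¹) (Metric.ball 0 r) := by
  have : Nontrivial E := Module.nontrivial_of_finrank_pos (R := ℝ) (by omega)
  rw [integrableOn_fun_norm_addHaar (μ := volume) (f := fun t : ℝ => t⁻¹)]
  have h : IntegrableOn (fun y : ℝ => y ^ (Module.finrank ℝ E - 2)) (Set.Ioo 0 r) :=
    ((continuous_pow _).integrableOn_Icc (a := 0) (b := r)).mono_set Set.Ioo_subset_Icc_self
  refine h.congr_fun (fun y hy => ?_) measurableSet_Ioo
  obtain ⟨k, hk⟩ := Nat.exists_eq_add_of_le hE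
  have hy0 : y ≠ 0 := hy.1.ne'
  have h1 : 2 + k - 1 = k + 1 := by omega
  have h2 : 2 + k - 2 = k := by omega
  simp only [hk, h1, h2, smul_eq_mul, pow_succ]
  field_simp

lemma integrableOn_inv_norm_sub_ball (hE : 2 ≤ Module.finrank ℝ E) (y : E) (r : ℝ) :
    IntegrableOn (fun x : E => ‖x - y‖⁻¹) (Metric.ball y r) := by
  have h := (integrable_indicator_iff measurableSet_ball).2 (integrableOn_inv_norm_ball hE r)
  rw [← integrable_indicator_iff measurableSet_ball]
  exact (h.comp_sub_right y).congr
    (ae_of_all _ fun x => (indicator_ball_inv_norm_sub x y r).symm)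

lemma setIntegral_inv_norm_sub_ball (hE : 2 ≤ Module.finrank ℝ E) (y : E) {r : ℝ} (hr : 0 < r) :
    ∫ x in Metric.ball y r, ‖x - y‖⁻¹ =
      r ^ (Module.finrank ℝ E - 1) * ∫ z in Metric.ball (0 : E) 1, ‖z‖⁻¹ := by
  have h1 : ∫ x in Metric.ball y r, ‖x - y‖⁻¹ = ∫ z in Metric.ball (0 : E) r, ‖z‖⁻¹ := by
    rw [← integral_indicator measurableSet_ball, ← integral_indicator measurableSet_ball,
      ← integral_sub_right_eq_self ((Metric.ball (0 : E) r).indicator fun z => ‖z‖⁻¹) y]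
    exact integral_congr_ae (ae_of_all _ fun x => indicator_ball_inv_norm_sub x y r)
  have h2 := Measure.setIntegral_comp_smul_of_pos (volume : Measure E)
    (fun z : E => ‖z‖⁻¹) (Metric.ball 0 1) hr
  rw [smul_unitBall_of_pos hr] at h2
  rw [h1]
  obtain ⟨k, hk⟩ := Nat.exists_eq_add_of_le hE
  have h3 : 2 + k - 1 = k + 1 := by omega
  simp only [norm_smul, mul_inv, integral_const_mul, smul_eq_mul, Real.norm_eq_abs,
    abs_of_pos hr] at h2
  rw [hk] at h2 ⊢
  rw [h3]
  refine mul_left_cancel₀ (inv_ne_zero hr.ne') ?_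
  have hpow : r ^ (2 + k) = r ^ (k + 1) * r := by ring
  have hr' := pow_pos hr (k + 1)
  rw [hpow, mul_inv, mul_assoc, eq_inv_mul_iff_mul_eq₀ hr'.ne'] at h2
  rw [← h2]
  ring

/-- The Riesz potential of a ball is bounded, uniformly in the pole, by the scaling-critical
power of the radius. -/
lemma exists_setIntegral_inv_norm_sub_le (hE : 2 ≤ Module.finrank ℝ E) :
    ∃ A : ℝ, 0 ≤ A ∧ ∀ (p y : E) (r : ℝ), 0 < r →
      IntegrableOn (fun x : E => ‖x - y‖⁻¹) (Metric.ball p r) ∧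
      ∫ x in Metric.ball p r, ‖x - y‖⁻¹ ≤ A * r ^ (Module.finrank ℝ E - 1) := by
  have : Nontrivial E := Module.nontrivial_of_finrank_pos (R := ℝ) (by omega)
  set I := ∫ z in Metric.ball (0 : E) 1, ‖z‖⁻¹ with hI
  have hI0 : 0 ≤ I := integral_nonneg fun z => by positivity
  refine ⟨volume.real (Metric.ball (0 : E) 1) + I, by positivity, fun p y r hr => ?_⟩
  have hind := (integrable_indicator_iff measurableSet_ball).2
    (integrableOn_inv_norm_sub_ball hE y r)
  have hfin : volume (Metric.ball p r) ≠ ⊤ := measure_ball_lt_top.ne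
  have hc : IntegrableOn (fun _ : E => r⁻¹) (Metric.ball p r) := integrableOn_const hfin
  have hsum := hc.add hind.integrableOn
  have hint : IntegrableOn (fun x : E => ‖x - y‖⁻¹) (Metric.ball p r) := by
    refine hsum.mono' (by fun_prop) (ae_of_all _ fun x => ?_)
    rw [Real.norm_of_nonneg (by positivity)]
    exact inv_norm_sub_le x y hr
  refine ⟨hint, ?_⟩
  calc ∫ x in Metric.ball p r, ‖x - y‖⁻¹
      ≤ ∫ x in Metric.ball p r, (r⁻¹ + (Metric.ball y r).indicator (fun x => ‖x - y‖⁻¹) x) :=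
        integral_mono hint hsum fun x => inv_norm_sub_le x y hr
    _ = volume.real (Metric.ball p r) * r⁻¹ +
          ∫ x in Metric.ball p r, (Metric.ball y r).indicator (fun x => ‖x - y‖⁻¹) x := by
        rw [integral_add hc hind.integrableOn, setIntegral_const, smul_eq_mul]
    _ ≤ volume.real (Metric.ball p r) * r⁻¹ + ∫ x in Metric.ball y r, ‖x - y‖⁻¹ := by
        rw [← integral_indicator (s := Metric.ball y r) measurableSet_ball]
        exact add_le_add_right (setIntegral_le_integral hind
          (ae_of_all _ fun x => Set.indicator_nonneg (fun _ _ => by positivity) x)) _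
    _ = _ := by
        rw [setIntegral_inv_norm_sub_ball hE y hr, measureReal_def, Measure.addHaar_ball _ _ hr.le,
          ENNReal.toReal_mul, ENNReal.toReal_ofReal (by positivity), ← measureReal_def]
        obtain ⟨k, hk⟩ := Nat.exists_eq_add_of_le hE
        have h3 : 2 + k - 1 = k + 1 := by omega
        rw [hk, h3, ← hI, pow_add r 2 k]
        field_simp
        ring

end RieszKernel

/-! ### Pointwise bounds for the logarithmic kernel -/

section LogKernel

/-- The inequality `log t ≤ t - 1` is applied to the ratio and to its inverse. The result dominates
the logarithm by kernels whose integrability in `(x, y)` is already controlled. -/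
lemma abs_log_norm_div_le {E : Type*} [SeminormedAddCommGroup E] (x y : E) :
    |Real.log (‖y‖ / ‖x - y‖)| ≤ ‖x‖ * ‖x - y‖⁻¹ + ‖x‖ * ‖y‖⁻¹ := by
  have hR : 0 ≤ ‖x‖ * ‖x - y‖⁻¹ + ‖x‖ * ‖y‖⁻¹ := by positivity
  rcases (norm_nonneg y).eq_or_lt with hy | hy
  -- At `y = 0`, and below at `x = y`, the logarithm takes the default value `log 0 = 0`.
  · simpa [← hy] using hR
  rcases (norm_nonneg (x - y)).eq_or_lt with hxy | hxy
  · rw [← hxy]; simpa using by positivity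
  have h1 : ‖y‖ ≤ ‖x - y‖ + ‖x‖ := by
    have := norm_sub_le x (x - y); simp at this; linarith
  have h2 : ‖x - y‖ ≤ ‖x‖ + ‖y‖ := norm_sub_le x y
  have key : ∀ a b : ℝ, 0 < a → 0 < b → a ≤ b + ‖x‖ → Real.log (a / b) ≤ ‖x‖ * b⁻¹ := by
    intro a b ha hb hab
    have := Real.log_le_sub_one_of_pos (div_pos ha hb)
    have h : a / b ≤ 1 + ‖x‖ * b⁻¹ := by
      rw [div_le_iff₀ hb]; field_simp; linarith
    linarith
  have k1 := key _ _ hy hxy h1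
  have k2 := key _ _ hxy hy (by linarith)
  have h3 : Real.log (‖x - y‖ / ‖y‖) = - Real.log (‖y‖ / ‖x - y‖) := by
    rw [← Real.log_inv, inv_div]
  have p1 : 0 ≤ ‖x‖ * ‖x - y‖⁻¹ := by positivity
  have p2 : 0 ≤ ‖x‖ * ‖y‖⁻¹ := by positivity
  rw [abs_le]
  constructor <;> linarith

/-- Error of the regularised logarithm. -/
lemma abs_half_log_sub_log_le {t ε : ℝ} (ht : 0 < t) (hε : 0 < ε) :
    |Real.log (t ^ 2 + ε ^ 2) / 2 - Real.log t| ≤ ε * t⁻¹ := by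
  have h1 : Real.log (t ^ 2 + ε ^ 2) / 2 - Real.log t =
      Real.log ((t ^ 2 + ε ^ 2) / t ^ 2) / 2 := by
    rw [Real.log_div (by positivity) (by positivity), Real.log_pow]; push_cast; ring
  have h2 : 1 ≤ (t ^ 2 + ε ^ 2) / t ^ 2 := by
    rw [le_div_iff₀ (by positivity)]; nlinarith
  have h3 : (t ^ 2 + ε ^ 2) / t ^ 2 ≤ ((t + ε) / t) ^ 2 := by
    rw [div_pow]; gcongr; nlinarith
  have h4 := Real.log_le_log (by positivity) h3
  rw [Real.log_pow] at h4
  have h5 := Real.log_le_sub_one_of_pos (show 0 < (t + ε) / t by positivity)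
  have h6 : (t + ε) / t - 1 = ε * t⁻¹ := by field_simp; ring
  rw [h1, abs_of_nonneg (by have := Real.log_nonneg h2; positivity)]
  push_cast at h4
  linarith

end LogKernel

/-! ### Integration by parts for the dilation field -/

section DilationDivergence

variable {E : Type*} [NormedAddCommGroup E] [InnerProductSpace ℝ E]

/-- The divergence of the vector field `x ↦ w x • x`. -/
noncomputable def dilationDiv (w : E → ℝ) (x : E) : ℝ :=
  Module.finrank ℝ E * w x + fderiv ℝ w x x

lemma continuous_fderiv_apply_self {w : E → ℝ} (hw : ContDiff ℝ 1 w) :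
    Continuous fun x => fderiv ℝ w x x :=
  (hw.continuous_fderiv one_ne_zero).clm_apply continuous_id

lemma hasCompactSupport_fderiv_apply_self {w : E → ℝ} (hc : HasCompactSupport w) :
    HasCompactSupport fun x => fderiv ℝ w x x :=
  (hc.fderiv (𝕜 := ℝ)).mono fun x hx h => hx (by simp [h])

lemma continuous_dilationDiv {w : E → ℝ} (hw : ContDiff ℝ 1 w) : Continuous (dilationDiv w) :=
  (continuous_const.mul hw.continuous).add (continuous_fderiv_apply_self hw)

lemma hasCompactSupport_dilationDiv {w : E → ℝ} (hc : HasCompactSupport w) :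
    HasCompactSupport (dilationDiv w) :=
  (HasCompactSupport.mul_left hc).add (hasCompactSupport_fderiv_apply_self hc)

lemma dilationDiv_mul {w v : E → ℝ} (hw : ContDiff ℝ 1 w) (hv : ContDiff ℝ 1 v) (x : E) :
    dilationDiv (fun x => w x * v x) x = dilationDiv w x * v x + w x * fderiv ℝ v x x := by
  have := fderiv_fun_mul (hw.differentiable one_ne_zero x) (hv.differentiable one_ne_zero x)
  simp only [dilationDiv, this]
  simp
  ring

variable [FiniteDimensional ℝ E] [MeasurableSpace E] [BorelSpace E]

/-- In an orthonormal basis each `∫ xᵢ ∂ᵢw` equals `-∫ w`, and there are as many terms as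
dimensions. -/
lemma integral_dilationDiv {w : E → ℝ} (hw : ContDiff ℝ 1 w) (hc : HasCompactSupport w) :
    ∫ x, dilationDiv w x = 0 := by
  have hfd : ∀ v : E, Continuous fun x => fderiv ℝ w x v := fun v =>
    (hw.continuous_fderiv one_ne_zero).clm_apply continuous_const
  have hcfd : ∀ v : E, HasCompactSupport fun x => fderiv ℝ w x v := fun v =>
    hc.fderiv_apply ℝ v
  set b := stdOrthonormalBasis ℝ E
  have hi : ∀ i, ∫ x, inner ℝ (b i) x * fderiv ℝ w x (b i) = - ∫ x, w x := by
    intro i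
    have hd : ∀ x, fderiv ℝ (fun x => inner ℝ (b i) x) x (b i) = 1 := fun x => by
      have := (innerSL ℝ (b i)).hasFDerivAt (x := x)
      have h2 : fderiv ℝ (fun x => inner ℝ (b i) x) x = innerSL ℝ (b i) := this.fderiv
      rw [h2]; simp
    rw [integral_mul_fderiv_eq_neg_fderiv_mul_of_integrable]
    · simp [hd]
    · simp only [hd, one_mul]
      exact hw.continuous.integrable_of_hasCompactSupport hc
    · exact ((by fun_prop : Continuous fun x => inner ℝ (b i) x).mul
        (hfd _)).integrable_of_hasCompactSupport (hcfd _).mul_left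
    · exact ((by fun_prop : Continuous fun x => inner ℝ (b i) x).mul
        hw.continuous).integrable_of_hasCompactSupport hc.mul_left
    · intro x _; exact (innerSL ℝ (b i)).differentiableAt
    · intro x _; exact hw.differentiable one_ne_zero x
  have hsum : ∀ x, fderiv ℝ w x x = ∑ i, inner ℝ (b i) x * fderiv ℝ w x (b i) := by
    intro x
    conv_lhs => arg 2; rw [← b.sum_repr' x]
    simp [map_sum]
  simp only [dilationDiv]
  rw [integral_add ((hw.continuous.integrable_of_hasCompactSupport hc).const_mul _)
    ((continuous_fderiv_apply_self hw).integrable_of_hasCompactSupport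
      (hasCompactSupport_fderiv_apply_self hc))]
  simp_rw [hsum]
  have hint : ∀ i, Integrable fun x => inner ℝ (b i) x * fderiv ℝ w x (b i) := fun i =>
    ((by fun_prop : Continuous fun x => inner ℝ (b i) x).mul
        (hfd _)).integrable_of_hasCompactSupport (hcfd _).mul_left
  rw [integral_finsetSum _ fun i _ => hint i]
  simp [hi, integral_const_mul]

lemma integral_dilationDiv_mul {w v : E → ℝ} (hw : ContDiff ℝ 1 w) (hc : HasCompactSupport w)
    (hv : ContDiff ℝ 1 v) :
    ∫ x, dilationDiv w x * v x = - ∫ x, w x * fderiv ℝ v x x := by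
  have h := integral_dilationDiv (hw.mul hv) hc.mul_right
  have h1 : Integrable fun x => dilationDiv w x * v x :=
    ((continuous_dilationDiv hw).mul hv.continuous).integrable_of_hasCompactSupport
      (hasCompactSupport_dilationDiv hc).mul_right
  have h2 : Integrable fun x => w x * fderiv ℝ v x x :=
    (hw.continuous.mul (continuous_fderiv_apply_self hv)).integrable_of_hasCompactSupport
      hc.mul_right
  rw [integral_congr_ae (ae_of_all _ (dilationDiv_mul hw hv)), integral_add h1 h2] at h
  linarith

/-- Integration by parts against the regularised logarithmic kernel. -/
lemma integral_dilationDiv_mul_log {w : E → ℝ} (hw : ContDiff ℝ 1 w) (hc : HasCompactSupport w)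
    (a : ℝ) (y : E) {ε : ℝ} (hε : 0 < ε) :
    ∫ x, dilationDiv w x * (a - Real.log (‖x - y‖ ^ 2 + ε ^ 2) / 2) =
      ∫ x, w x * (inner ℝ (x - y) x / (‖x - y‖ ^ 2 + ε ^ 2)) := by
  have hpos : ∀ x : E, ‖x - y‖ ^ 2 + ε ^ 2 ≠ 0 := fun x => by positivity
  have hsq : ContDiff ℝ 1 fun x : E => ‖x - y‖ ^ 2 + ε ^ 2 :=
    ((contDiff_id.sub contDiff_const).norm_sq ℝ).add contDiff_const
  have hv : ContDiff ℝ 1 fun x : E => a - Real.log (‖x - y‖ ^ 2 + ε ^ 2) / 2 :=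
    contDiff_const.sub ((hsq.log hpos).div_const 2)
  rw [integral_dilationDiv_mul hw hc hv, ← integral_neg]
  refine integral_congr_ae (ae_of_all _ fun x => ?_)
  have h1 : HasFDerivAt (fun x : E => ‖x - y‖ ^ 2 + ε ^ 2)
      (2 • (innerSL ℝ (x - y)).comp (ContinuousLinearMap.id ℝ E)) x :=
    (((hasFDerivAt_id x).sub_const y).norm_sq).add_const _
  have h2 := (((h1.log (hpos x)).mul_const 2⁻¹).const_sub a).fderiv
  simp only [div_eq_mul_inv, h2]
  simp [-mul_eq_mul_left_iff, inner_sub_left]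
  ring

end DilationDivergence

/-! ### Absolute convergence of the double integrals -/

section Potential

lemma exists_ball_bound_of_hasCompactSupport {E : Type*} [NormedAddCommGroup E] {g : E → ℝ}
    (hg : Continuous g)
    (hc : HasCompactSupport g) :
    ∃ M r : ℝ, 0 < r ∧ ∀ x, ‖g x‖ ≤ (Metric.ball (0 : E) r).indicator (fun _ => M) x := by
  obtain ⟨M, hM⟩ := hg.bounded_above_of_compact_support hc
  obtain ⟨r, hr, hs⟩ := hc.isCompact.isBounded.subset_ball_lt 0 0
  refine ⟨M, r, hr, fun x => ?_⟩
  by_cases hx : x ∈ Metric.ball (0 : E) r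
  · simpa only [Set.indicator_of_mem hx] using hM x
  · have : x ∉ tsupport g := fun h => hx (hs h)
    simp [Set.indicator_of_notMem hx, image_eq_zero_of_notMem_tsupport this]

variable {E : Type*} [NormedAddCommGroup E] [InnerProductSpace ℝ E] [FiniteDimensional ℝ E]
  [MeasurableSpace E] [BorelSpace E]

/-- On the unit ball `f` is bounded and `‖y‖⁻¹` is integrable; outside it `‖y‖⁻¹ ≤ 1`. -/
lemma integrable_mul_inv_norm (hE : 2 ≤ Module.finrank ℝ E) {f : E → ℝ} (hf : Continuous f)
    (hfi : Integrable f) : Integrable fun y => f y * ‖y‖⁻¹ := by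
  obtain ⟨M, hM⟩ := (isCompact_closedBall (0 : E) 1).exists_bound_of_continuousOn hf.continuousOn
  have hind := (integrable_indicator_iff measurableSet_ball).2
    (integrableOn_inv_norm_sub_ball hE (0 : E) 1)
  refine (hfi.norm.add (hind.const_mul M)).mono' (by fun_prop) (ae_of_all _ fun y => ?_)
  have h := inv_norm_sub_le y (0 : E) one_pos
  simp only [Pi.add_apply, norm_mul, norm_inv, norm_norm]
  by_cases hy : y ∈ Metric.ball (0 : E) 1
  · have := hM y (Metric.ball_subset_closedBall hy)
    simp only [Set.indicator_of_mem hy, sub_zero]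
    have h3 : ‖f y‖ * ‖y‖⁻¹ ≤ M * ‖y‖⁻¹ := by gcongr
    linarith [norm_nonneg (f y)]
  · simp only [Set.indicator_of_notMem hy, sub_zero, inv_one, add_zero, mul_zero] at h ⊢
    exact mul_le_of_le_one_right (norm_nonneg _) h

/-- Tonelli, integrating in `x` first: the inner integral over the ball is bounded uniformly in `y`,
leaving a multiple of `|f y|`. -/
lemma integrable_prod_mul_inv_norm_sub (hE : 2 ≤ Module.finrank ℝ E) {g f : E → ℝ}
    (hg : AEStronglyMeasurable g) {M r : ℝ} {p : E} (hr : 0 < r)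
    (hgM : ∀ x, ‖g x‖ ≤ (Metric.ball p r).indicator (fun _ => M) x) (hf : Integrable f) :
    Integrable fun q : E × E => g q.1 * f q.2 * ‖q.1 - q.2‖⁻¹ := by
  obtain ⟨A, hA0, hA⟩ := exists_setIntegral_inv_norm_sub_le hE
  have hmeas : AEStronglyMeasurable (fun q : E × E => g q.1 * f q.2 * ‖q.1 - q.2‖⁻¹)
      (volume.prod volume) :=
    (hg.comp_fst.mul hf.aestronglyMeasurable.comp_snd).mul (by fun_prop)
  have hM0 : 0 ≤ M := by
    have := hgM p
    rw [Set.indicator_of_mem (Metric.mem_ball_self hr)] at this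
    exact (norm_nonneg _).trans this
  have hpt : ∀ y x, ‖g x * f y * ‖x - y‖⁻¹‖ ≤
      (Metric.ball p r).indicator (fun x => (M * ‖f y‖) * ‖x - y‖⁻¹) x := by
    intro y x
    have h1 := hgM x
    rw [norm_mul, norm_mul, norm_inv, norm_norm]
    by_cases hx : x ∈ Metric.ball p r
    · simp only [Set.indicator_of_mem hx] at h1 ⊢
      gcongr
    · simp only [Set.indicator_of_notMem hx] at h1 ⊢
      have : ‖g x‖ = 0 := le_antisymm h1 (norm_nonneg _)
      simp [this]
  have hdom : ∀ y, Integrable ((Metric.ball p r).indicator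
      fun x => (M * ‖f y‖) * ‖x - y‖⁻¹) := fun y =>
    (integrable_indicator_iff measurableSet_ball).2 ((hA p y r hr).1.const_mul _)
  have hslice : ∀ y, Integrable fun x => g x * f y * ‖x - y‖⁻¹ := fun y =>
    (hdom y).mono' ((hg.mul_const _).mul (by fun_prop)) (ae_of_all _ (hpt y))
  refine (integrable_prod_iff' hmeas).2 ⟨ae_of_all _ hslice, ?_⟩
  refine (hf.norm.const_mul (M * (A * r ^ (Module.finrank ℝ E - 1)))).mono'
    hmeas.prod_swap.norm.integral_prod_right' (ae_of_all _ fun y => ?_)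
  rw [Real.norm_of_nonneg (integral_nonneg fun x => norm_nonneg _)]
  calc ∫ x, ‖g x * f y * ‖x - y‖⁻¹‖
      ≤ ∫ x, (Metric.ball p r).indicator (fun x => (M * ‖f y‖) * ‖x - y‖⁻¹) x :=
        integral_mono (hslice y).norm (hdom y) (hpt y)
    _ = (M * ‖f y‖) * ∫ x in Metric.ball p r, ‖x - y‖⁻¹ := by
        rw [integral_indicator measurableSet_ball, integral_const_mul]
    _ ≤ (M * ‖f y‖) * (A * r ^ (Module.finrank ℝ E - 1)) := by
        gcongr
        exact (hA p y r hr).2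
    _ = _ := by ring

/-- The factor `‖x‖` of the kernel bound is absorbed into `g`. Only measurability and a ball bound
are asked of `g`, so that it may be a divergence or the indicator of a ball. -/
lemma integrable_prod_mul_log (hE : 2 ≤ Module.finrank ℝ E) {g f : E → ℝ}
    (hg : AEStronglyMeasurable g) {M r : ℝ} {p : E} (hr : 0 < r)
    (hgM : ∀ x, ‖g x‖ ≤ (Metric.ball p r).indicator (fun _ => M) x) (hf : Integrable f)
    (hf' : Integrable fun y => f y * ‖y‖⁻¹) :
    Integrable fun q : E × E => g q.1 * f q.2 * Real.log (‖q.2‖ / ‖q.1 - q.2‖) := by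
  have hgM' : ∀ x, ‖g x * ‖x‖‖ ≤
      (Metric.ball p r).indicator (fun _ => M * (‖p‖ + r)) x := by
    intro x
    have h1 := hgM x
    rw [norm_mul, norm_norm]
    by_cases hx : x ∈ Metric.ball p r
    · simp only [Set.indicator_of_mem hx] at h1 ⊢
      have h2 : ‖x‖ ≤ ‖p‖ + r := by
        have h3 : ‖x - p‖ < r := by simpa [dist_eq_norm] using hx
        have h4 := norm_add_le p (x - p)
        rw [add_sub_cancel] at h4
        linarith
      have := (norm_nonneg _).trans h1
      gcongr
    · simp only [Set.indicator_of_notMem hx] at h1 ⊢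
      simp [le_antisymm h1 (norm_nonneg _)]
  have hgm : AEStronglyMeasurable fun x => g x * ‖x‖ := hg.mul (by fun_prop)
  have hgi : Integrable fun x => g x * ‖x‖ :=
    ((integrable_indicator_iff measurableSet_ball).2
      (integrableOn_const (measure_ball_lt_top.ne))).mono' hgm (ae_of_all _ hgM')
  have h1 := integrable_prod_mul_inv_norm_sub hE hgm hr hgM' hf
  have h2 := hgi.mul_prod hf'
  refine (h1.norm.add h2.norm).mono'
    ((hg.comp_fst.mul hf.aestronglyMeasurable.comp_snd).mul ?_) (ae_of_all _ fun q => ?_)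
  · exact (by fun_prop : Measurable fun q : E × E =>
      Real.log (‖q.2‖ / ‖q.1 - q.2‖)).aestronglyMeasurable
  · simp only [Pi.add_apply, norm_mul, norm_norm, norm_inv]
    have := abs_log_norm_div_le q.1 q.2
    calc _ ≤ ‖g q.1‖ * ‖f q.2‖ * (‖q.1‖ * ‖q.1 - q.2‖⁻¹ + ‖q.1‖ * ‖q.2‖⁻¹) := by
          gcongr; exact this
      _ = _ := by ring

end Potential

/-! ### Pohozaev symmetrisation of the double integral -/

section Pohozaev

/-- Cauchy–Schwarz; the bound is uniform in `ε`, hence usable for domination as `ε → 0`. -/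
lemma abs_inner_div_le {E : Type*} [NormedAddCommGroup E] [InnerProductSpace ℝ E]
    (a b : E) (ε : ℝ) :
    ‖inner ℝ a b / (‖a‖ ^ 2 + ε ^ 2)‖ ≤ ‖b‖ * ‖a‖⁻¹ := by
  rcases eq_or_ne a 0 with rfl | ha
  · simp
  have hpos : 0 < ‖a‖ := norm_pos_iff.2 ha
  rw [norm_div, Real.norm_of_nonneg (by positivity : 0 ≤ ‖a‖ ^ 2 + ε ^ 2), ← div_eq_mul_inv,
    div_le_div_iff₀ (by positivity) hpos]
  have h1 : ‖inner ℝ a b‖ ≤ ‖a‖ * ‖b‖ := norm_inner_le_norm a b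
  calc ‖inner ℝ a b‖ * ‖a‖ ≤ ‖a‖ * ‖b‖ * ‖a‖ := by gcongr
    _ ≤ ‖b‖ * (‖a‖ ^ 2 + ε ^ 2) := by nlinarith [mul_nonneg (norm_nonneg b) (sq_nonneg ε)]

variable {E : Type*} [NormedAddCommGroup E] [InnerProductSpace ℝ E] [FiniteDimensional ℝ E]
  [MeasurableSpace E] [BorelSpace E]

lemma ae_prod_ne (hE : 2 ≤ Module.finrank ℝ E) :
    ∀ᵐ q : E × E, q.2 ≠ 0 ∧ q.1 ≠ q.2 := by
  have : Nontrivial E := Module.nontrivial_of_finrank_pos (R := ℝ) (by omega)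
  have hs : MeasurableSet {q : E × E | q.2 ≠ 0 ∧ q.1 ≠ q.2} :=
    ((isOpen_ne_fun continuous_snd continuous_const).inter
      (isOpen_ne_fun continuous_fst continuous_snd)).measurableSet
  refine (Measure.ae_prod_mem_iff_ae_ae_mem (μ := (volume : Measure E))
    (ν := (volume : Measure E)) hs).2 (ae_of_all _ fun x => ?_)
  filter_upwards [Measure.ae_ne (volume : Measure E) 0, Measure.ae_ne (volume : Measure E) x]
    with y h1 h2 using ⟨h1, fun h => h2 h.symm⟩

lemma integrable_prod_mul_inner_div (hE : 2 ≤ Module.finrank ℝ E) {w f : E → ℝ}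
    (hw : Continuous w) (hc : HasCompactSupport w) (hf : Integrable f) (ε : ℝ) :
    Integrable fun q : E × E =>
      w q.1 * f q.2 * (inner ℝ (q.1 - q.2) q.1 / (‖q.1 - q.2‖ ^ 2 + ε ^ 2)) := by
  have hw' : Continuous fun x => w x * ‖x‖ := by fun_prop
  obtain ⟨M, r, hr, hM⟩ := exists_ball_bound_of_hasCompactSupport hw' hc.mul_right
  refine (integrable_prod_mul_inv_norm_sub hE hw'.aestronglyMeasurable hr hM hf).norm.mono'
    ((hw.aestronglyMeasurable.comp_fst.mul hf.aestronglyMeasurable.comp_snd).mul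
      (by fun_prop : Measurable fun q : E × E =>
        inner ℝ (q.1 - q.2) q.1 / (‖q.1 - q.2‖ ^ 2 + ε ^ 2)).aestronglyMeasurable)
    (ae_of_all _ fun q => ?_)
  have h := abs_inner_div_le (q.1 - q.2) q.1 ε
  rw [norm_mul]
  calc _ ≤ ‖w q.1 * f q.2‖ * (‖q.1‖ * ‖q.1 - q.2‖⁻¹) := by gcongr
    _ = _ := by simp only [norm_mul, norm_norm, norm_inv]; ring

/-- Before the limit, integration by parts in `x` trades the gradient of the regularised kernel for
the regularised logarithm. The latter is within `ε ‖x - y‖⁻¹` of the true one, so the error is `ε`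
times a finite integral. -/
lemma tendsto_integral_mul_inner_div (hE : 2 ≤ Module.finrank ℝ E) {w f : E → ℝ}
    (hw : ContDiff ℝ 1 w) (hc : HasCompactSupport w) (hf : Integrable f)
    (hf' : Integrable fun y => f y * ‖y‖⁻¹) :
    Tendsto (fun ε : ℝ => ∫ q : E × E,
        w q.1 * f q.2 * (inner ℝ (q.1 - q.2) q.1 / (‖q.1 - q.2‖ ^ 2 + ε ^ 2))) (𝓝[>] 0)
      (𝓝 (∫ q : E × E, dilationDiv w q.1 * f q.2 * Real.log (‖q.2‖ / ‖q.1 - q.2‖))) := by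
  have hg := continuous_dilationDiv hw
  obtain ⟨M, r, hr, hM⟩ := exists_ball_bound_of_hasCompactSupport hg
    (hasCompactSupport_dilationDiv hc)
  have hK := integrable_prod_mul_inv_norm_sub hE hg.aestronglyMeasurable hr hM hf
  have h0 := integrable_prod_mul_log hE hg.aestronglyMeasurable hr hM hf hf'
  set J₀ : E × E → ℝ := fun q => dilationDiv w q.1 * f q.2 * Real.log (‖q.2‖ / ‖q.1 - q.2‖)
    with hJ₀
  set J : ℝ → E × E → ℝ := fun ε q =>
    dilationDiv w q.1 * f q.2 * (Real.log ‖q.2‖ - Real.log (‖q.1 - q.2‖ ^ 2 + ε ^ 2) / 2) with hJ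
  have hJm : ∀ ε, AEStronglyMeasurable (J ε) := fun ε =>
    (hg.aestronglyMeasurable.comp_fst.mul hf.aestronglyMeasurable.comp_snd).mul
      (by fun_prop : Measurable fun q : E × E =>
        Real.log ‖q.2‖ - Real.log (‖q.1 - q.2‖ ^ 2 + ε ^ 2) / 2).aestronglyMeasurable
  have hdiff : ∀ ε : ℝ, 0 < ε → ∀ᵐ q : E × E, ‖J ε q - J₀ q‖ ≤
      ε * ‖dilationDiv w q.1 * f q.2 * ‖q.1 - q.2‖⁻¹‖ := by
    intro ε hε
    filter_upwards [ae_prod_ne hE] with q hq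
    have hq1 : 0 < ‖q.1 - q.2‖ := norm_pos_iff.2 (sub_ne_zero.2 hq.2)
    have hq2 : 0 < ‖q.2‖ := norm_pos_iff.2 hq.1
    have h := abs_half_log_sub_log_le hq1 hε
    rw [hJ, hJ₀]
    simp only
    rw [Real.log_div hq2.ne' hq1.ne', ← mul_sub, norm_mul, norm_mul _ (‖q.1 - q.2‖⁻¹),
      Real.norm_of_nonneg (inv_nonneg.2 hq1.le)]
    have h' : ‖Real.log ‖q.2‖ - Real.log (‖q.1 - q.2‖ ^ 2 + ε ^ 2) / 2 -
        (Real.log ‖q.2‖ - Real.log ‖q.1 - q.2‖)‖ ≤ ε * ‖q.1 - q.2‖⁻¹ := by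
      rw [Real.norm_eq_abs, ← abs_neg]
      convert h using 2
      ring
    calc _ ≤ ‖dilationDiv w q.1 * f q.2‖ * (ε * ‖q.1 - q.2‖⁻¹) := by gcongr
      _ = _ := by ring
  have hJi : ∀ ε : ℝ, 0 < ε → Integrable (J ε) := by
    intro ε hε
    have h1 : Integrable (fun q => J ε q - J₀ q) :=
      (hK.norm.const_mul ε).mono' ((hJm ε).sub h0.aestronglyMeasurable) (hdiff ε hε)
    exact (h1.add h0).congr (ae_of_all _ fun q => by simp)
  have hlim : Tendsto (fun ε => ∫ q, J ε q) (𝓝[>] 0) (𝓝 (∫ q, J₀ q)) := by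
    rw [tendsto_iff_norm_sub_tendsto_zero]
    have hb : Tendsto (fun ε : ℝ => ε * ∫ q : E × E,
        ‖dilationDiv w q.1 * f q.2 * ‖q.1 - q.2‖⁻¹‖) (𝓝[>] 0) (𝓝 0) := by
      have h1 : Tendsto (fun ε : ℝ => ε) (𝓝[>] 0) (𝓝 0) := nhdsWithin_le_nhds
      simpa using h1.mul_const (∫ q : E × E, ‖dilationDiv w q.1 * f q.2 * ‖q.1 - q.2‖⁻¹‖)
    refine tendsto_of_tendsto_of_tendsto_of_le_of_le' tendsto_const_nhds hb
      (Eventually.of_forall fun _ => norm_nonneg _) ?_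
    filter_upwards [self_mem_nhdsWithin] with ε hε
    rw [← integral_sub (hJi ε hε) h0, ← integral_const_mul]
    exact norm_integral_le_of_norm_le (hK.norm.const_mul ε) (hdiff ε hε)
  refine hlim.congr' ?_
  filter_upwards [self_mem_nhdsWithin] with ε hε
  -- The `x` integral must be the inner one: the integration by parts is in `x`, with the pole `y`
  -- fixed.
  rw [Measure.volume_eq_prod, integral_prod_symm _ (hJi ε hε),
    integral_prod_symm _ (integrable_prod_mul_inner_div hE hw.continuous hc hf ε)]
  refine integral_congr_ae (ae_of_all _ fun y => ?_)
  have h := congrArg (f y * ·) (integral_dilationDiv_mul_log hw hc (Real.log ‖y‖) y hε)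
  simp only [← integral_const_mul] at h
  simp only [hJ]
  refine Eq.trans (integral_congr_ae (ae_of_all _ fun x => ?_))
    (h.trans (integral_congr_ae (ae_of_all _ fun x => ?_)))
  · simp only; ring
  · simp only; ring

/-- Average the integrand with its image under `(x, y) ↦ (y, x)`: the factor `x - y` changes sign,
which produces the difference `η(x)x - η(y)y`. -/
lemma integral_symmetrize_inner_div (hE : 2 ≤ Module.finrank ℝ E) {η f : E → ℝ}
    (hη : Continuous η) (hc : HasCompactSupport η) (hfc : Continuous f) (hf : Integrable f)
    (ε : ℝ) :
    ∫ q : E × E, η q.1 * f q.1 * f q.2 *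
        (inner ℝ (q.1 - q.2) q.1 / (‖q.1 - q.2‖ ^ 2 + ε ^ 2)) =
      (∫ q : E × E, f q.1 * f q.2 *
        (inner ℝ (q.1 - q.2) (η q.1 • q.1 - η q.2 • q.2) / (‖q.1 - q.2‖ ^ 2 + ε ^ 2))) / 2 := by
  have hi := integrable_prod_mul_inner_div hE (hη.mul hfc) hc.mul_right hf ε
  set h : E × E → ℝ := fun q => η q.1 * f q.1 * f q.2 *
        (inner ℝ (q.1 - q.2) q.1 / (‖q.1 - q.2‖ ^ 2 + ε ^ 2)) with hh
  have hi' : Integrable h := hi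
  have hswap : ∫ q : E × E, h q.swap = ∫ q, h q := integral_prod_swap (μ := volume) (ν := volume) h
  have hadd : ∫ q : E × E, (h q + h q.swap) = (∫ q, h q) + ∫ q : E × E, h q.swap :=
    integral_add hi' (Integrable.swap hi')
  have hcongr : ∫ q : E × E, f q.1 * f q.2 *
      (inner ℝ (q.1 - q.2) (η q.1 • q.1 - η q.2 • q.2) / (‖q.1 - q.2‖ ^ 2 + ε ^ 2)) =
      ∫ q : E × E, (h q + h q.swap) := by
    refine integral_congr_ae (ae_of_all _ fun q => ?_)
    simp only [hh, Prod.fst_swap, Prod.snd_swap, inner_sub_right, inner_smul_right,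
      norm_sub_rev q.2 q.1]
    rw [← neg_sub q.1 q.2, inner_neg_left]
    ring
  rw [hcongr, hadd, hswap]
  ring

/-- The Pohozaev symmetrisation: the singular double integral against a divergence becomes an
integral with a bounded kernel. -/
lemma integral_dilationDiv_mul_log_prod (hE : 2 ≤ Module.finrank ℝ E) {η f : E → ℝ}
    (hη : ContDiff ℝ 1 η) (hc : HasCompactSupport η) (hfc : ContDiff ℝ 1 f) (hf : Integrable f) :
    ∫ q : E × E, dilationDiv (fun x => η x * f x) q.1 * f q.2 *
        Real.log (‖q.2‖ / ‖q.1 - q.2‖) =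
      (∫ q : E × E, f q.1 * f q.2 *
        (inner ℝ (q.1 - q.2) (η q.1 • q.1 - η q.2 • q.2) / ‖q.1 - q.2‖ ^ 2)) / 2 := by
  have h1 := tendsto_integral_mul_inner_div hE (hη.mul hfc) hc.mul_right hf
    (integrable_mul_inv_norm hE hfc.continuous hf)
  have hX : ContDiff ℝ 1 fun x => η x • x := hη.smul contDiff_id
  -- The Lipschitz constant of `x ↦ η(x)x` cancels the singularity and bounds the symmetrised kernel
  -- uniformly in `ε`.
  obtain ⟨L, hL⟩ := ContDiff.lipschitzWith_of_hasCompactSupport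
    (f := fun x => η x • x) hc.smul_right hX one_ne_zero
  refine tendsto_nhds_unique h1 ?_
  simp only [integral_symmetrize_inner_div hE hη.continuous hc hfc.continuous hf]
  refine Tendsto.div_const ?_ 2
  have hff : Integrable fun q : E × E => f q.1 * f q.2 := hf.mul_prod hf
  refine tendsto_integral_filter_of_dominated_convergence (fun q => ‖f q.1 * f q.2‖ * L) ?_ ?_
    (hff.norm.mul_const _) ?_
  · refine Eventually.of_forall fun ε => hff.aestronglyMeasurable.mul ?_
    have := hη.continuous.measurable
    exact (by fun_prop : Measurable fun q : E × E =>
      inner ℝ (q.1 - q.2) (η q.1 • q.1 - η q.2 • q.2) /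
        (‖q.1 - q.2‖ ^ 2 + ε ^ 2)).aestronglyMeasurable
  · refine Eventually.of_forall fun ε => ae_of_all _ fun q => ?_
    rw [norm_mul]
    refine mul_le_mul_of_nonneg_left ((abs_inner_div_le _ _ ε).trans ?_) (norm_nonneg _)
    have h2 := hL.norm_sub_le q.1 q.2
    exact mul_inv_le_of_le_mul₀ (norm_nonneg _) L.2 h2
  · refine ae_of_all _ fun q => Tendsto.const_mul _ ?_
    rcases eq_or_ne q.1 q.2 with h | h
    · simp [h]
    · have hq : ‖q.1 - q.2‖ ^ 2 ≠ 0 := by simpa [sub_eq_zero] using h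
      have h3 : Tendsto (fun ε : ℝ => ‖q.1 - q.2‖ ^ 2 + ε ^ 2) (𝓝[>] 0)
          (𝓝 (‖q.1 - q.2‖ ^ 2)) := by
        refine Tendsto.mono_left ?_ nhdsWithin_le_nhds
        exact ((by fun_prop : Continuous fun ε : ℝ => ‖q.1 - q.2‖ ^ 2 + ε ^ 2)).tendsto' 0 _
          (by simp)
      exact tendsto_const_nhds.div h3 hq

end Pohozaev

/-! ### Exhausting cut-offs with scale-invariant bounds -/

section DilatedBump

variable {E : Type*} [NormedAddCommGroup E] [InnerProductSpace ℝ E]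

/-- The cut-off `x ↦ χ (x / (k + 1))`. -/
noncomputable def dilatedBump (χ : ContDiffBump (0 : E)) (k : ℕ) (x : E) : ℝ :=
  χ (((k : ℝ) + 1)⁻¹ • x)

/-- The radial derivative commutes with dilations, so it is bounded uniformly in `k` and tends to
`0` pointwise. -/
lemma fderiv_dilatedBump_apply_self (χ : ContDiffBump (0 : E)) (k : ℕ) (x : E) :
    fderiv ℝ (dilatedBump χ k) x x =
      fderiv ℝ χ (((k : ℝ) + 1)⁻¹ • x) (((k : ℝ) + 1)⁻¹ • x) := by
  have h : dilatedBump χ k = fun x => χ (((k : ℝ) + 1)⁻¹ • x) := rfl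
  rw [h, fderiv_comp_smul]
  simp

lemma tendsto_inv_smul {E : Type*} [NormedAddCommGroup E] [NormedSpace ℝ E] (x : E) :
    Tendsto (fun k : ℕ => ((k : ℝ) + 1)⁻¹ • x) atTop (𝓝 0) := by
  have h : Tendsto (fun k : ℕ => ((k : ℝ) + 1)⁻¹) atTop (𝓝 0) := by
    simpa using tendsto_one_div_add_atTop_nhds_zero_nat (𝕜 := ℝ)
  simpa using h.smul_const x

variable [FiniteDimensional ℝ E]

lemma contDiff_dilatedBump (χ : ContDiffBump (0 : E)) (k : ℕ) :
    ContDiff ℝ 1 (dilatedBump χ k) :=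
  χ.contDiff.comp (contDiff_const_smul _)

lemma hasCompactSupport_dilatedBump (χ : ContDiffBump (0 : E)) (k : ℕ) :
    HasCompactSupport (dilatedBump χ k) :=
  χ.hasCompactSupport.comp_homeomorph
    (Homeomorph.smulOfNeZero (((k : ℝ) + 1)⁻¹) (by positivity))

lemma tendsto_dilatedBump (χ : ContDiffBump (0 : E)) (x : E) :
    Tendsto (fun k => dilatedBump χ k x) atTop (𝓝 1) := by
  have h := (χ.continuous.tendsto 0).comp (tendsto_inv_smul x)
  rwa [χ.one_of_mem_closedBall (Metric.mem_closedBall_self χ.rIn_pos.le)] at h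

/-- Conjugating the field `x ↦ χ(x)x` by a dilation preserves its Lipschitz constant, so `L` does
not depend on `k`. -/
lemma exists_lipschitz_dilatedBump_smul (χ : ContDiffBump (0 : E)) :
    ∃ L : ℝ, ∀ k x y, ‖dilatedBump χ k x • x - dilatedBump χ k y • y‖ ≤ L * ‖x - y‖ := by
  obtain ⟨L, hL⟩ := ContDiff.lipschitzWith_of_hasCompactSupport
    (f := fun x => χ x • x) χ.hasCompactSupport.smul_right
    ((χ.contDiff (n := 1)).smul contDiff_id) one_ne_zero
  refine ⟨L, fun k x y => ?_⟩
  have hk : (0 : ℝ) < (k : ℝ) + 1 := by positivity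
  have h := hL.norm_sub_le (((k : ℝ) + 1)⁻¹ • x) (((k : ℝ) + 1)⁻¹ • y)
  rw [smul_comm _ _ x, smul_comm _ _ y, ← smul_sub, ← smul_sub, norm_smul, norm_smul,
    norm_inv, Real.norm_of_nonneg hk.le] at h
  have h2 := mul_le_mul_of_nonneg_left h hk.le
  rwa [mul_inv_cancel_left₀ hk.ne', mul_left_comm, mul_inv_cancel_left₀ hk.ne'] at h2

end DilatedBump

/-! ### Pohozaev's identity, its inequality and the equality case -/

section PohozaevInequality

variable {E : Type*} [NormedAddCommGroup E] [InnerProductSpace ℝ E] [FiniteDimensional ℝ E]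
  [MeasurableSpace E] [BorelSpace E]

lemma dilationDiv_mul_mul_exp {E : Type*} [NormedAddCommGroup E] [InnerProductSpace ℝ E]
    {η Q u : E → ℝ} (hη : ContDiff ℝ 1 η) (hQ : ContDiff ℝ 1 Q) (hu : ContDiff ℝ 1 u)
    (a : ℝ) (x : E) :
    dilationDiv (fun x => η x * (Q x * Real.exp (a * u x))) x =
      (Module.finrank ℝ E * (η x * (Q x * Real.exp (a * u x))) +
        fderiv ℝ η x x * (Q x * Real.exp (a * u x)) +
        η x * (fderiv ℝ Q x x * Real.exp (a * u x))) +
      a * (η x * (Q x * Real.exp (a * u x)) * fderiv ℝ u x x) := by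
  have h1 := (hη.differentiable one_ne_zero x).hasFDerivAt
  have h2 := (hQ.differentiable one_ne_zero x).hasFDerivAt
  have h3 := (hu.differentiable one_ne_zero x).hasFDerivAt
  have h := (h1.mul (h2.mul (h3.const_mul a).exp)).fderiv
  have h' : fderiv ℝ (fun x => η x * (Q x * Real.exp (a * u x))) x = _ := h
  simp only [dilationDiv, h']
  simp
  ring

/-- Pohozaev's identity for a logarithmic potential, localised by a cut-off `η`. -/
lemma pohozaev_cutoff (hE : 2 ≤ Module.finrank ℝ E) {η Q u : E → ℝ} (hη : ContDiff ℝ 1 η)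
    (hc : HasCompactSupport η) (hQ : ContDiff ℝ 1 Q) (hu : ContDiff ℝ 1 u) {a b C : ℝ}
    (hf : Integrable fun x => Q x * Real.exp (a * u x))
    (hrep : ∀ x, u x = b * (∫ y, Real.log (‖y‖ / ‖x - y‖) * (Q y * Real.exp (a * u y))) + C) :
    ∫ x, (Module.finrank ℝ E * (η x * (Q x * Real.exp (a * u x))) +
        fderiv ℝ η x x * (Q x * Real.exp (a * u x)) +
        η x * (fderiv ℝ Q x x * Real.exp (a * u x))) =
      a * b / 2 * ∫ q : E × E, (Q q.1 * Real.exp (a * u q.1)) * (Q q.2 * Real.exp (a * u q.2)) *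
        (inner ℝ (q.1 - q.2) (η q.1 • q.1 - η q.2 • q.2) / ‖q.1 - q.2‖ ^ 2) := by
  set f : E → ℝ := fun x => Q x * Real.exp (a * u x) with hfdef
  have hfc : ContDiff ℝ 1 f := hQ.mul (contDiff_const.mul hu).exp
  have hw : ContDiff ℝ 1 fun x => η x * f x := hη.mul hfc
  have hcw : HasCompactSupport fun x => η x * f x := hc.mul_right
  have hG := continuous_dilationDiv hw
  have hGc := hasCompactSupport_dilationDiv hcw
  obtain ⟨M, r, hr, hM⟩ := exists_ball_bound_of_hasCompactSupport hG hGc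
  have hprod := integrable_prod_mul_log hE hG.aestronglyMeasurable hr hM hf
    (integrable_mul_inv_norm hE hfc.continuous hf)
  have hGi : Integrable (dilationDiv fun x => η x * f x) := hG.integrable_of_hasCompactSupport hGc
  have hGu : ∫ x, dilationDiv (fun x => η x * f x) x * u x =
      b * ∫ q : E × E, dilationDiv (fun x => η x * f x) q.1 * f q.2 *
        Real.log (‖q.2‖ / ‖q.1 - q.2‖) := by
    rw [Measure.volume_eq_prod, integral_prod _ hprod, ← integral_const_mul]
    have h1 : ∀ x, dilationDiv (fun x => η x * f x) x * u x =
        b * (∫ y, dilationDiv (fun x => η x * f x) x * f y * Real.log (‖y‖ / ‖x - y‖)) +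
          C * dilationDiv (fun x => η x * f x) x := by
      intro x
      have h2 : ∫ y, dilationDiv (fun x => η x * f x) x * f y * Real.log (‖y‖ / ‖x - y‖) =
          dilationDiv (fun x => η x * f x) x * ∫ y, Real.log (‖y‖ / ‖x - y‖) * f y := by
        rw [← integral_const_mul]
        exact integral_congr_ae (ae_of_all _ fun y => by simp only; ring)
      rw [h2, hrep x]
      ring
    simp_rw [h1]
    -- The additive constant `C` drops out because a compactly supported divergence has integral
    -- zero.
    rw [integral_add (hprod.integral_prod_left.const_mul b) (hGi.const_mul C),
      integral_const_mul C, integral_dilationDiv hw hcw]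
    simp
  have hparts := integral_dilationDiv_mul hw hcw hu
  have hwu : Integrable fun x => η x * f x * fderiv ℝ u x x :=
    (hw.continuous.mul (continuous_fderiv_apply_self hu)).integrable_of_hasCompactSupport
      hcw.mul_right
  have hzero := integral_dilationDiv hw hcw
  have hsplit : ∫ x, (Module.finrank ℝ E * (η x * f x) + fderiv ℝ η x x * f x +
      η x * (fderiv ℝ Q x x * Real.exp (a * u x))) =
      ∫ x, (dilationDiv (fun x => η x * f x) x - a * (η x * f x * fderiv ℝ u x x)) := by
    refine integral_congr_ae (ae_of_all _ fun x => ?_)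
    have := dilationDiv_mul_mul_exp hη hQ hu a x
    simp only [hfdef] at this ⊢
    linarith
  rw [hsplit, integral_sub hGi (hwu.const_mul a), hzero, integral_const_mul]
  rw [integral_dilationDiv_mul_log_prod hE hη hc hfc hf] at hGu
  rw [hGu] at hparts
  linear_combination (-a) * hparts

/-- Pohozaev's identity for a logarithmic potential, in the limit of exhausting cut-offs. -/
lemma tendsto_pohozaev (hE : 2 ≤ Module.finrank ℝ E) (χ : ContDiffBump (0 : E))
    {Q u : E → ℝ} (hQ : ContDiff ℝ 1 Q) (hu : ContDiff ℝ 1 u) {a b C : ℝ}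
    (hf : Integrable fun x => Q x * Real.exp (a * u x))
    (hrep : ∀ x, u x = b * (∫ y, Real.log (‖y‖ / ‖x - y‖) * (Q y * Real.exp (a * u y))) + C) :
    Tendsto (fun k => ∫ x, dilatedBump χ k x * (fderiv ℝ Q x x * Real.exp (a * u x))) atTop
      (𝓝 (a * b / 2 * (∫ x, Q x * Real.exp (a * u x)) ^ 2 -
        Module.finrank ℝ E * ∫ x, Q x * Real.exp (a * u x))) := by
  set f : E → ℝ := fun x => Q x * Real.exp (a * u x) with hfdef
  have hη := contDiff_dilatedBump χ
  have hc := hasCompactSupport_dilatedBump χ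
  have hfc : ContDiff ℝ 1 f := hQ.mul (contDiff_const.mul hu).exp
  have hχ1 : ContDiff ℝ 1 χ := χ.contDiff
  have hff : Integrable fun q : E × E => f q.1 * f q.2 := hf.mul_prod hf
  have hT1 : Tendsto (fun k => ∫ x, dilatedBump χ k x * f x) atTop (𝓝 (∫ x, f x)) := by
    refine tendsto_integral_of_dominated_convergence (fun x => ‖f x‖)
      (fun k => ((hη k).continuous.mul hfc.continuous).aestronglyMeasurable) hf.norm ?_ ?_
    · refine fun k => ae_of_all _ fun x => ?_
      rw [norm_mul, Real.norm_of_nonneg (show 0 ≤ dilatedBump χ k x from χ.nonneg)]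
      exact mul_le_of_le_one_left (norm_nonneg _) χ.le_one
    · refine ae_of_all _ fun x => ?_
      simpa using (tendsto_dilatedBump χ x).mul_const (f x)
  have hT2 : Tendsto (fun k => ∫ x, fderiv ℝ (dilatedBump χ k) x x * f x) atTop (𝓝 0) := by
    have hg := continuous_fderiv_apply_self hχ1
    obtain ⟨M, hM⟩ := hg.bounded_above_of_compact_support
      (hasCompactSupport_fderiv_apply_self χ.hasCompactSupport)
    have h0 : (0 : ℝ) = ∫ x : E, (0 : ℝ) := by simp
    rw [h0]
    refine tendsto_integral_of_dominated_convergence (fun x => M * ‖f x‖)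
      (fun k => ((continuous_fderiv_apply_self (hη k)).mul hfc.continuous).aestronglyMeasurable)
      (hf.norm.const_mul M) ?_ ?_
    · refine fun k => ae_of_all _ fun x => ?_
      rw [norm_mul, fderiv_dilatedBump_apply_self]
      exact mul_le_mul_of_nonneg_right (hM _) (norm_nonneg _)
    · refine ae_of_all _ fun x => ?_
      simp only [fderiv_dilatedBump_apply_self]
      have h := ((hg.tendsto 0).comp (tendsto_inv_smul x)).mul_const (f x)
      simpa using h
  have hT3 : Tendsto (fun k => ∫ q : E × E, f q.1 * f q.2 *
      (inner ℝ (q.1 - q.2) (dilatedBump χ k q.1 • q.1 - dilatedBump χ k q.2 • q.2) /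
        ‖q.1 - q.2‖ ^ 2)) atTop (𝓝 ((∫ x, f x) ^ 2)) := by
    obtain ⟨L, hL⟩ := exists_lipschitz_dilatedBump_smul χ
    have hsq : (∫ x, f x) ^ 2 = ∫ q : E × E, f q.1 * f q.2 := by
      rw [Measure.volume_eq_prod, integral_prod_mul, sq]
    rw [hsq]
    refine tendsto_integral_of_dominated_convergence (fun q => ‖f q.1 * f q.2‖ * L)
      (fun k => hff.aestronglyMeasurable.mul ?_) (hff.norm.mul_const L) ?_ ?_
    · have := (hη k).continuous.measurable
      exact (by fun_prop : Measurable fun q : E × E =>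
        inner ℝ (q.1 - q.2) (dilatedBump χ k q.1 • q.1 - dilatedBump χ k q.2 • q.2) /
          ‖q.1 - q.2‖ ^ 2).aestronglyMeasurable
    · refine fun k => (ae_prod_ne hE).mono fun q hq => ?_
      have hpos : 0 < ‖q.1 - q.2‖ := norm_pos_iff.2 (sub_ne_zero.2 hq.2)
      rw [norm_mul]
      refine mul_le_mul_of_nonneg_left ?_ (norm_nonneg _)
      rw [norm_div, Real.norm_of_nonneg (by positivity : 0 ≤ ‖q.1 - q.2‖ ^ 2),
        div_le_iff₀ (by positivity)]
      refine (norm_inner_le_norm _ _).trans ?_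
      nlinarith [hL k q.1 q.2]
    · refine (ae_prod_ne hE).mono fun q hq => ?_
      have hpos : 0 < ‖q.1 - q.2‖ := norm_pos_iff.2 (sub_ne_zero.2 hq.2)
      have h1 : Tendsto (fun k => dilatedBump χ k q.1 • q.1 - dilatedBump χ k q.2 • q.2) atTop
          (𝓝 (q.1 - q.2)) := by
        simpa using ((tendsto_dilatedBump χ q.1).smul_const q.1).sub
          ((tendsto_dilatedBump χ q.2).smul_const q.2)
      have h2 := (((tendsto_const_nhds (x := q.1 - q.2)).inner (𝕜 := ℝ) h1).div_const
        (‖q.1 - q.2‖ ^ 2)).const_mul (f q.1 * f q.2)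
      rwa [real_inner_self_eq_norm_sq, div_self (by positivity), mul_one] at h2
  have h := ((hT3.const_mul (a * b / 2)).sub (hT1.const_mul (Module.finrank ℝ E : ℝ))).sub hT2
  rw [sub_zero] at h
  refine h.congr fun k => ?_
  have hk := pohozaev_cutoff hE (hη k) (hc k) hQ hu hf hrep
  have i1 : Integrable fun x => dilatedBump χ k x * f x :=
    ((hη k).continuous.mul hfc.continuous).integrable_of_hasCompactSupport (hc k).mul_right
  have i2 : Integrable fun x => fderiv ℝ (dilatedBump χ k) x x * f x :=
    ((continuous_fderiv_apply_self (hη k)).mul hfc.continuous).integrable_of_hasCompactSupport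
      (hasCompactSupport_fderiv_apply_self (hc k)).mul_right
  have i3 : Integrable fun x => dilatedBump χ k x * (fderiv ℝ Q x x * Real.exp (a * u x)) :=
    ((hη k).continuous.mul ((continuous_fderiv_apply_self hQ).mul
      (Real.continuous_exp.comp (continuous_const.mul
        hu.continuous)))).integrable_of_hasCompactSupport (hc k).mul_right
  have e1 := integral_add ((i1.const_mul (Module.finrank ℝ E : ℝ)).add i2) i3
  have e2 := integral_add (i1.const_mul (Module.finrank ℝ E : ℝ)) i2
  simp only [Pi.add_apply] at e1
  rw [e1, e2, integral_const_mul] at hk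
  linarith

/-- For a radially nonincreasing `Q`, the total mass is bounded, and if the bound is attained
then `Q` is constant along rays. -/
lemma pohozaev_of_fderiv_nonpos (hE : 2 ≤ Module.finrank ℝ E)
    {Q u : E → ℝ} (hQ : ContDiff ℝ 1 Q) (hu : ContDiff ℝ 1 u) {a b C : ℝ}
    (hf : Integrable fun x => Q x * Real.exp (a * u x))
    (hrep : ∀ x, u x = b * (∫ y, Real.log (‖y‖ / ‖x - y‖) * (Q y * Real.exp (a * u y))) + C)
    (hrad : ∀ x, fderiv ℝ Q x x ≤ 0) :
    a * b / 2 * (∫ x, Q x * Real.exp (a * u x)) ^ 2 ≤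
        Module.finrank ℝ E * ∫ x, Q x * Real.exp (a * u x) ∧
      (a * b / 2 * (∫ x, Q x * Real.exp (a * u x)) ^ 2 =
        Module.finrank ℝ E * ∫ x, Q x * Real.exp (a * u x) → ∀ x, fderiv ℝ Q x x = 0) := by
  let χ : ContDiffBump (0 : E) := ⟨1, 2, one_pos, one_lt_two⟩
  have hlim := tendsto_pohozaev hE χ hQ hu hf hrep
  set h : E → ℝ := fun x => fderiv ℝ Q x x * Real.exp (a * u x) with hh
  have hh0 : ∀ x, h x ≤ 0 := fun x => mul_nonpos_of_nonpos_of_nonneg (hrad x) (Real.exp_pos _).le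
  have hhc : Continuous h := (continuous_fderiv_apply_self hQ).mul
    (Real.continuous_exp.comp (continuous_const.mul hu.continuous))
  have hint : ∀ k, Integrable fun x => dilatedBump χ k x * h x := fun k =>
    ((contDiff_dilatedBump χ k).continuous.mul hhc).integrable_of_hasCompactSupport
      (hasCompactSupport_dilatedBump χ k).mul_right
  have hle : ∀ k x, dilatedBump χ k x * h x ≤ 0 := fun k x =>
    mul_nonpos_of_nonneg_of_nonpos χ.nonneg (hh0 x)
  refine ⟨sub_nonpos.1 (le_of_tendsto hlim (Eventually.of_forall fun k =>
    integral_nonpos (hle k))), fun heq x => ?_⟩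
  rw [heq, sub_self] at hlim
  -- The `m`-th cut-off vanishes outside radius `2(m + 1)`, and the `k`-th is `1` up to radius `k +
  -- 1 ≥ 2(m + 1)`. Comparing cut-offs in this way avoids asking that `h` be integrable.
  have hmono : ∀ m k : ℕ, 2 * m + 1 ≤ k → ∀ y,
      dilatedBump χ k y * h y ≤ dilatedBump χ m y * h y := by
    intro m k hmk y
    refine mul_le_mul_of_nonpos_right ?_ (hh0 y)
    have hm0 : (0 : ℝ) < (m : ℝ) + 1 := by positivity
    have hk0 : (0 : ℝ) < (k : ℝ) + 1 := by positivity
    by_cases hy : ‖y‖ < 2 * ((m : ℝ) + 1)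
    · have h1 : ((k : ℝ) + 1)⁻¹ • y ∈ Metric.closedBall (0 : E) χ.rIn := by
        rw [mem_closedBall_zero_iff, norm_smul, norm_inv, Real.norm_of_nonneg hk0.le]
        refine inv_mul_le_of_le_mul₀ hk0.le zero_le_one ?_
        have : (2 * m + 1 : ℝ) ≤ k := by exact_mod_cast hmk
        linarith
      rw [dilatedBump, dilatedBump, χ.one_of_mem_closedBall h1]
      exact χ.le_one
    · have h1 : dilatedBump χ m y = 0 := by
        refine χ.zero_of_le_dist ?_
        rw [dist_zero_right, norm_smul, norm_inv, Real.norm_of_nonneg hm0.le,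
          inv_mul_eq_div, le_div_iff₀ hm0]
        exact not_lt.1 hy
      rw [h1]
      exact χ.nonneg
  -- Each integral is nonpositive, yet at least the later ones, which tend to `0`.
  have hzero : ∀ m, ∫ y, dilatedBump χ m y * h y = 0 := fun m =>
    le_antisymm (integral_nonpos (hle m)) (le_of_tendsto hlim
      ((eventually_ge_atTop (2 * m + 1)).mono fun k hk =>
        integral_mono (hint k) (hint m) (hmono m k hk)))
  have hpt : ∀ m, dilatedBump χ m x * h x = 0 := by
    intro m
    by_contra hne
    have hpos := Continuous.integral_pos_of_hasCompactSupport_nonneg_nonzero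
      (μ := (volume : Measure E)) (f := fun y => dilatedBump χ m y * -h y) (x := x)
      ((contDiff_dilatedBump χ m).continuous.mul hhc.neg)
      (hasCompactSupport_dilatedBump χ m).mul_right
      (fun y => by simpa using hle m y) (by simpa using hne)
    simp only [mul_neg, integral_neg, hzero m, neg_zero, lt_irrefl] at hpos
  have hx : h x = 0 := by
    have h1 := (tendsto_dilatedBump χ x).mul_const (h x)
    simp only [hpt, one_mul] at h1
    exact (tendsto_nhds_unique h1 tendsto_const_nhds)
  exact (mul_eq_zero.1 hx).resolve_right (Real.exp_pos _).ne'

/-- Mean value theorem on the segment from `0` to `x`: at an interior `t > 0` the derivative along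
the ray is `t⁻¹` times the vanishing radial derivative. -/
lemma eq_apply_zero_of_fderiv_apply_self_eq_zero {E : Type*} [NormedAddCommGroup E]
    [NormedSpace ℝ E] {Q : E → ℝ} (hQ : Differentiable ℝ Q) (h : ∀ x, fderiv ℝ Q x x = 0)
    (x : E) : Q x = Q 0 := by
  have hd : ∀ t : ℝ, HasDerivAt (fun t : ℝ => Q (t • x)) (fderiv ℝ Q (t • x) x) t := fun t => by
    have h1 : HasDerivAt (fun t : ℝ => t • x) x t := by
      simpa using (hasDerivAt_id t).smul_const x
    exact (hQ (t • x)).hasFDerivAt.comp_hasDerivAt t h1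
  obtain ⟨t, ht, hslope⟩ := exists_hasDerivAt_eq_slope (fun t : ℝ => Q (t • x))
    (fun t => fderiv ℝ Q (t • x) x) one_pos
    (fun t _ => (hd t).continuousAt.continuousWithinAt) (fun t _ => hd t)
  have h2 := h (t • x)
  rw [map_smul, smul_eq_mul] at h2
  have h3 := (mul_eq_zero.1 h2).resolve_left ht.1.ne'
  simp [h3] at hslope
  linarith

end PohozaevInequality

/-! ### Ball means of the potential and the lower mass bound -/

section Averages

/-- Here the `y`-singularity carries no factor `‖x‖`, and the growth in `x` away from the pole is
only logarithmic. This survives division by `log ‖p‖`. -/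
lemma abs_log_norm_div_le_log_add {E : Type*} [SeminormedAddCommGroup E] (x y : E) :
    |Real.log (‖y‖ / ‖x - y‖)| ≤ ‖x‖ * ‖x - y‖⁻¹ + Real.log (1 + ‖x‖) + ‖y‖⁻¹ := by
  have hlog : 0 ≤ Real.log (1 + ‖x‖) := Real.log_nonneg (by linarith [norm_nonneg x])
  have hR : 0 ≤ ‖x‖ * ‖x - y‖⁻¹ + Real.log (1 + ‖x‖) + ‖y‖⁻¹ := by positivity
  rcases (norm_nonneg y).eq_or_lt with hy | hy
  · simpa [← hy] using hR
  rcases (norm_nonneg (x - y)).eq_or_lt with hxy | hxy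
  · rw [← hxy]; simpa using by positivity
  have p1 : 0 ≤ ‖x‖ * ‖x - y‖⁻¹ := by positivity
  have p2 : 0 ≤ ‖y‖⁻¹ := by positivity
  rw [abs_le]
  constructor
  · have h1 : ‖x - y‖ / ‖y‖ ≤ (1 + ‖x‖) * (1 + ‖y‖⁻¹) := by
      rw [div_le_iff₀ hy]
      have h2 : (1 + ‖x‖) * (1 + ‖y‖⁻¹) * ‖y‖ = (1 + ‖x‖) * (‖y‖ + 1) := by field_simp
      rw [h2]
      nlinarith [norm_sub_le x y, norm_nonneg x]
    have h3 := Real.log_le_log (by positivity) h1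
    rw [Real.log_mul (by positivity) (by positivity)] at h3
    have h4 := Real.log_le_sub_one_of_pos (show 0 < 1 + ‖y‖⁻¹ by positivity)
    have h5 : Real.log (‖x - y‖ / ‖y‖) = - Real.log (‖y‖ / ‖x - y‖) := by
      rw [← Real.log_inv, inv_div]
    linarith
  · have h1 : ‖y‖ / ‖x - y‖ ≤ 1 + ‖x‖ * ‖x - y‖⁻¹ := by
      rw [div_le_iff₀ hxy]
      have := norm_sub_le x (x - y)
      rw [sub_sub_cancel] at this
      field_simp
      linarith
    have := Real.log_le_sub_one_of_pos (div_pos hy hxy)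
    linarith

variable {E : Type*} [NormedAddCommGroup E] [InnerProductSpace ℝ E] [FiniteDimensional ℝ E]
  [MeasurableSpace E] [BorelSpace E]

lemma measureReal_ball_pos {p : E} {r : ℝ} (hr : 0 < r) :
    0 < volume.real (Metric.ball p r) :=
  ENNReal.toReal_pos (Metric.measure_ball_pos _ _ hr).ne' measure_ball_lt_top.ne

/-- The mean over `B(p, r|p|)` of the logarithmic kernel with pole `y`. -/
noncomputable def logKernelMean (r : ℝ) (p y : E) : ℝ :=
  ⨍ x in Metric.ball p (r * ‖p‖), Real.log (‖y‖ / ‖x - y‖)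

lemma norm_bounds_of_mem_ball {E : Type*} [SeminormedAddCommGroup E] {r : ℝ} {p x : E}
    (hx : x ∈ Metric.ball p (r * ‖p‖)) : (1 - r) * ‖p‖ ≤ ‖x‖ ∧ ‖x‖ ≤ (1 + r) * ‖p‖ := by
  have h3 : ‖x - p‖ < r * ‖p‖ := by simpa [dist_eq_norm] using hx
  have h4 := norm_add_le p (x - p)
  have h5 := norm_sub_le x (x - p)
  rw [add_sub_cancel] at h4
  rw [sub_sub_cancel] at h5
  constructor <;> linarith

/-- By scaling, the mean of `‖p‖ ‖x - y‖⁻¹` over a ball of radius `r‖p‖` is bounded uniformly in `p`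
and `y`. After division by `log ‖p‖` the estimate serves as the dominating function. -/
lemma exists_abs_logKernelMean_le (hE : 2 ≤ Module.finrank ℝ E) {r : ℝ} (hr0 : 0 < r)
    (hr1 : r < 1) :
    ∃ D : ℝ, 0 ≤ D ∧ ∀ p y : E, 1 ≤ ‖p‖ →
      |logKernelMean r p y| ≤ D + Real.log ‖p‖ + ‖y‖⁻¹ := by
  have : Nontrivial E := Module.nontrivial_of_finrank_pos (R := ℝ) (by omega)
  obtain ⟨A, hA0, hA⟩ := exists_setIntegral_inv_norm_sub_le hE
  set V := volume.real (Metric.ball (0 : E) 1) with hV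
  have hVpos : 0 < V := measureReal_ball_pos one_pos
  -- The first term is the scaled mean of `2‖p‖ ‖x - y‖⁻¹`; the `3` comes from `1 + ‖x‖ ≤ 3‖p‖`,
  -- valid since `‖p‖ ≥ 1` and `‖x‖ ≤ 2‖p‖`.
  refine ⟨2 * A / (V * r) + Real.log 3, by
    have := Real.log_nonneg (show (1 : ℝ) ≤ 3 by norm_num)
    positivity, fun p y hp => ?_⟩
  have hρ : 0 < r * ‖p‖ := by positivity
  set B := Metric.ball p (r * ‖p‖) with hB
  have hBvol : volume.real B = (r * ‖p‖) ^ Module.finrank ℝ E * V := by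
    rw [measureReal_def, Measure.addHaar_ball _ _ hρ.le,
          ENNReal.toReal_mul, ENNReal.toReal_ofReal (by positivity), ← measureReal_def]
  have hBpos : 0 < volume.real B := by rw [hBvol]; positivity
  obtain ⟨hAi, hAle⟩ := hA p y _ hρ
  have hpt : ∀ x ∈ B, ‖Real.log (‖y‖ / ‖x - y‖)‖ ≤
      2 * ‖p‖ * ‖x - y‖⁻¹ + (Real.log 3 + Real.log ‖p‖ + ‖y‖⁻¹) := by
    intro x hx
    have h1 := abs_log_norm_div_le_log_add x y
    have h2 : ‖x‖ ≤ 2 * ‖p‖ := (norm_bounds_of_mem_ball hx).2.trans (by nlinarith)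
    have h3 : Real.log (1 + ‖x‖) ≤ Real.log 3 + Real.log ‖p‖ := by
      rw [← Real.log_mul (by norm_num) (by positivity)]
      exact Real.log_le_log (by positivity) (by linarith)
    have h4 : ‖x‖ * ‖x - y‖⁻¹ ≤ 2 * ‖p‖ * ‖x - y‖⁻¹ := by gcongr
    rw [Real.norm_eq_abs]
    linarith
  have hdom : IntegrableOn
      (fun x => 2 * ‖p‖ * ‖x - y‖⁻¹ + (Real.log 3 + Real.log ‖p‖ + ‖y‖⁻¹)) B :=
    (hAi.const_mul _).add (integrableOn_const measure_ball_lt_top.ne)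
  have hle : ‖∫ x in B, Real.log (‖y‖ / ‖x - y‖)‖ ≤
      ∫ x in B, (2 * ‖p‖ * ‖x - y‖⁻¹ + (Real.log 3 + Real.log ‖p‖ + ‖y‖⁻¹)) :=
    norm_integral_le_of_norm_le hdom ((ae_restrict_iff' measurableSet_ball).2
      (ae_of_all _ hpt))
  rw [integral_add (hAi.const_mul _) (integrableOn_const measure_ball_lt_top.ne),
    integral_const_mul, setIntegral_const, smul_eq_mul] at hle
  rw [logKernelMean, setAverage_eq, smul_eq_mul, abs_mul, abs_of_pos (inv_pos.2 hBpos),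
    inv_mul_le_iff₀ hBpos]
  refine hle.trans ?_
  have h5 : 2 * ‖p‖ * ∫ x in B, ‖x - y‖⁻¹ ≤ volume.real B * (2 * A / (V * r)) := by
    refine (mul_le_mul_of_nonneg_left hAle (by positivity)).trans (le_of_eq ?_)
    rw [hBvol]
    obtain ⟨k, hk⟩ := Nat.exists_eq_add_of_le hE
    have h3 : 2 + k - 1 = k + 1 := by omega
    rw [hk, h3, pow_add _ 2 k]
    field_simp
    ring
  linarith

/-- For fixed `y` and large `‖p‖`, all `x` in the ball have `‖x - y‖` comparable to `‖p‖`, so the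
kernel is `-log ‖p‖ + O(1)`. -/
lemma tendsto_logKernelMean_div_log (hE : 2 ≤ Module.finrank ℝ E) {r : ℝ} (hr0 : 0 < r)
    (hr1 : r < 1) {p : ℕ → E} (hp : Tendsto (fun i => ‖p i‖) atTop atTop) {y : E} (hy : y ≠ 0) :
    Tendsto (fun i => logKernelMean r (p i) y / Real.log ‖p i‖) atTop (𝓝 (-1)) := by
  have : Nontrivial E := Module.nontrivial_of_finrank_pos (R := ℝ) (by omega)
  have hy0 : 0 < ‖y‖ := norm_pos_iff.2 hy
  have hlog : Tendsto (fun i => Real.log ‖p i‖) atTop atTop := Real.tendsto_log_atTop.comp hp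
  set D := |Real.log ‖y‖| + |Real.log ((1 - r) / 2)| + Real.log 3 with hD
  have hr1' : 0 < 1 - r := by linarith
  have hbound : ∀ᶠ i in atTop, ‖logKernelMean r (p i) y / Real.log ‖p i‖ - (-1)‖ ≤
      D / Real.log ‖p i‖ := by
    filter_upwards [hp.eventually_ge_atTop (2 * ‖y‖ / (1 - r)), hp.eventually_gt_atTop 1]
      with i hi hi1
    have hpi : 0 < ‖p i‖ := by linarith
    have hl : 0 < Real.log ‖p i‖ := Real.log_pos hi1
    have hρ : 0 < r * ‖p i‖ := by positivity
    have hBpos : 0 < volume.real (Metric.ball (p i) (r * ‖p i‖)) :=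
      measureReal_ball_pos hρ
    rw [div_le_iff₀ hr1'] at hi
    have hlower : ∀ x ∈ Metric.ball (p i) (r * ‖p i‖), (1 - r) / 2 * ‖p i‖ ≤ ‖x - y‖ ∧
        ‖x - y‖ ≤ 3 * ‖p i‖ := by
      intro x hx
      obtain ⟨h1, h2⟩ := norm_bounds_of_mem_ball hx
      have h3 := norm_sub_norm_le x y
      have h4 := norm_sub_le x y
      constructor
      · linarith
      · nlinarith
    have hpt : ∀ x ∈ Metric.ball (p i) (r * ‖p i‖),
        ‖Real.log (‖y‖ / ‖x - y‖) + Real.log ‖p i‖‖ ≤ D := by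
      intro x hx
      obtain ⟨h1, h2⟩ := hlower x hx
      have hpos : 0 < ‖x - y‖ := lt_of_lt_of_le (by positivity) h1
      have l1 := Real.log_le_log (by positivity) h1
      have l2 := Real.log_le_log hpos h2
      rw [Real.log_mul (by positivity) (by positivity)] at l1 l2
      rw [Real.log_div (by positivity) (by positivity), Real.norm_eq_abs, abs_le]
      have a1 := neg_abs_le (Real.log ‖y‖)
      have a2 := le_abs_self (Real.log ‖y‖)
      have a3 := neg_abs_le (Real.log ((1 - r) / 2))
      have a4 := abs_nonneg (Real.log ((1 - r) / 2))
      have a5 := Real.log_nonneg (show (1 : ℝ) ≤ 3 by norm_num)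
      constructor <;> linarith
    have hint : IntegrableOn (fun x => Real.log (‖y‖ / ‖x - y‖) + Real.log ‖p i‖)
        (Metric.ball (p i) (r * ‖p i‖)) :=
      (integrableOn_const (C := D) measure_ball_lt_top.ne).mono'
        ((by fun_prop : Measurable fun x : E =>
          Real.log (‖y‖ / ‖x - y‖) + Real.log ‖p i‖).aestronglyMeasurable)
        ((ae_restrict_iff' measurableSet_ball).2 (ae_of_all _ hpt))
    have hnorm := norm_setIntegral_le_of_norm_le_const
      (measure_ball_lt_top (μ := (volume : Measure E)) (x := p i) (r := r * ‖p i‖)) hpt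
    have hsub : ∫ x in Metric.ball (p i) (r * ‖p i‖), Real.log (‖y‖ / ‖x - y‖) =
        (∫ x in Metric.ball (p i) (r * ‖p i‖), (Real.log (‖y‖ / ‖x - y‖) + Real.log ‖p i‖)) -
          volume.real (Metric.ball (p i) (r * ‖p i‖)) * Real.log ‖p i‖ := by
      rw [← smul_eq_mul (volume.real _), ← setIntegral_const (μ := volume),
        ← integral_sub hint (integrableOn_const measure_ball_lt_top.ne)]
      simp
    have hmean : logKernelMean r (p i) y / Real.log ‖p i‖ - (-1) =
        (volume.real (Metric.ball (p i) (r * ‖p i‖)))⁻¹ *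
          (∫ x in Metric.ball (p i) (r * ‖p i‖), (Real.log (‖y‖ / ‖x - y‖) + Real.log ‖p i‖)) /
          Real.log ‖p i‖ := by
      rw [logKernelMean, setAverage_eq, smul_eq_mul, hsub]
      field_simp
      ring
    rw [hmean, norm_div, Real.norm_of_nonneg hl.le]
    refine div_le_div_of_nonneg_right ?_ hl.le
    rw [norm_mul, Real.norm_of_nonneg (inv_pos.2 hBpos).le, inv_mul_le_iff₀ hBpos]
    exact hnorm.trans_eq (mul_comm _ _)
  rw [tendsto_iff_norm_sub_tendsto_zero]
  exact tendsto_of_tendsto_of_tendsto_of_le_of_le' tendsto_const_nhds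
    (hlog.const_div_atTop D) (Eventually.of_forall fun _ => norm_nonneg _) hbound

lemma measurable_logKernelMean (r : ℝ) (p : E) : StronglyMeasurable (logKernelMean r p) := by
  have h : StronglyMeasurable fun q : E × E => Real.log (‖q.1‖ / ‖q.2 - q.1‖) :=
    (by fun_prop : Measurable fun q : E × E =>
      Real.log (‖q.1‖ / ‖q.2 - q.1‖)).stronglyMeasurable
  exact h.integral_prod_right

/-- The mean of a logarithmic potential over `B(p, r|p|)` in terms of the kernel means. -/
lemma setAverage_logPotential (hE : 2 ≤ Module.finrank ℝ E) {r : ℝ} (hr0 : 0 < r) {p : E}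
    (hp : p ≠ 0) {f u : E → ℝ} (hf : Integrable f) (hf' : Integrable fun y => f y * ‖y‖⁻¹)
    {b C : ℝ} (hrep : ∀ x, u x = b * (∫ y, Real.log (‖y‖ / ‖x - y‖) * f y) + C) :
    ⨍ x in Metric.ball p (r * ‖p‖), u x = b * (∫ y, f y * logKernelMean r p y) + C := by
  have hρ : 0 < r * ‖p‖ := mul_pos hr0 (norm_pos_iff.2 hp)
  set B := Metric.ball p (r * ‖p‖) with hB
  have hBpos : 0 < volume.real B :=
      measureReal_ball_pos hρ
  set g : E → ℝ := B.indicator fun _ => 1 with hg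
  have hgm : Measurable g := measurable_const.indicator measurableSet_ball
  have hprod := integrable_prod_mul_log hE hgm.aestronglyMeasurable hρ (M := 1) (p := p)
    (fun x => by
      by_cases hx : x ∈ B
      · simp [hg, ← hB, Set.indicator_of_mem hx]
      · simp [hg, ← hB, Set.indicator_of_notMem hx]) hf hf'
  have hswap := integral_integral_swap (f := fun x y => g x * f y * Real.log (‖y‖ / ‖x - y‖)) hprod
  have hL : ∀ x, ∫ y, g x * f y * Real.log (‖y‖ / ‖x - y‖) =
      B.indicator (fun x => ∫ y, Real.log (‖y‖ / ‖x - y‖) * f y) x := by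
    intro x
    by_cases hx : x ∈ B
    · simp [hg, Set.indicator_of_mem hx, mul_comm]
    · simp [hg, Set.indicator_of_notMem hx]
  have hR : ∀ y, ∫ x, g x * f y * Real.log (‖y‖ / ‖x - y‖) =
      volume.real B * (f y * logKernelMean r p y) := by
    intro y
    have h1 : ∀ x, g x * f y * Real.log (‖y‖ / ‖x - y‖) =
        f y * B.indicator (fun x => Real.log (‖y‖ / ‖x - y‖)) x := by
      intro x
      by_cases hx : x ∈ B
      · simp [hg, Set.indicator_of_mem hx]
      · simp [hg, Set.indicator_of_notMem hx]
    simp_rw [h1]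
    rw [integral_const_mul, integral_indicator measurableSet_ball, logKernelMean, setAverage_eq,
      smul_eq_mul, ← hB]
    field_simp
  have hPi : Integrable (B.indicator fun x => ∫ y, Real.log (‖y‖ / ‖x - y‖) * f y) :=
    hprod.integral_prod_left.congr (ae_of_all _ hL)
  simp_rw [hL, hR] at hswap
  rw [integral_indicator measurableSet_ball, integral_const_mul] at hswap
  rw [integrable_indicator_iff measurableSet_ball] at hPi
  rw [setAverage_eq, smul_eq_mul]
  simp_rw [hrep]
  rw [integral_add (hPi.const_mul b) (integrableOn_const measure_ball_lt_top.ne),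
    integral_const_mul, hswap, setIntegral_const, smul_eq_mul, ← hB]
  field_simp

lemma tendsto_setAverage_logPotential (hE : 2 ≤ Module.finrank ℝ E) {r : ℝ} (hr0 : 0 < r)
    (hr1 : r < 1) {p : ℕ → E} (hp : Tendsto (fun i => ‖p i‖) atTop atTop)
    {f u : E → ℝ} (hf : Integrable f) (hf' : Integrable fun y => f y * ‖y‖⁻¹)
    {b C : ℝ} (hrep : ∀ x, u x = b * (∫ y, Real.log (‖y‖ / ‖x - y‖) * f y) + C) :
    Tendsto (fun i => (⨍ x in Metric.ball (p i) (r * ‖p i‖), u x) / Real.log ‖p i‖) atTop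
      (𝓝 (-(b * ∫ y, f y))) := by
  have : Nontrivial E := Module.nontrivial_of_finrank_pos (R := ℝ) (by omega)
  obtain ⟨D, hD0, hD⟩ := exists_abs_logKernelMean_le (E := E) hE hr0 hr1
  have hlog : Tendsto (fun i => Real.log ‖p i‖) atTop atTop := Real.tendsto_log_atTop.comp hp
  have hT : Tendsto (fun i => ∫ y, f y * (logKernelMean r (p i) y / Real.log ‖p i‖)) atTop
      (𝓝 (∫ y, f y * (-1))) := by
    refine tendsto_integral_filter_of_dominated_convergence
      (fun y => (D + 1) * ‖f y‖ + ‖f y * ‖y‖⁻¹‖) ?_ ?_ ((hf.norm.const_mul _).add hf'.norm) ?_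
    · exact Eventually.of_forall fun i => hf.aestronglyMeasurable.mul
        ((measurable_logKernelMean r (p i)).measurable.div_const _).aestronglyMeasurable
    · filter_upwards [hlog.eventually_ge_atTop 1, hp.eventually_ge_atTop 1] with i hi hi1
      refine ae_of_all _ fun y => ?_
      have h1 := hD (p i) y hi1
      have hl : 0 < Real.log ‖p i‖ := by linarith
      have h2 : ‖logKernelMean r (p i) y / Real.log ‖p i‖‖ ≤ D + 1 + ‖y‖⁻¹ := by
        rw [norm_div, Real.norm_of_nonneg hl.le, div_le_iff₀ hl, Real.norm_eq_abs]
        have h3 : 0 ≤ ‖y‖⁻¹ := by positivity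
        nlinarith
      rw [norm_mul]
      calc _ ≤ ‖f y‖ * (D + 1 + ‖y‖⁻¹) := by gcongr
        _ = _ := by rw [norm_mul, norm_inv, norm_norm]; ring
    · filter_upwards [Measure.ae_ne (volume : Measure E) 0] with y hy
      exact (tendsto_logKernelMean_div_log hE hr0 hr1 hp hy).const_mul _
  have h := (hT.const_mul b).add (hlog.const_div_atTop C)
  rw [integral_mul_const] at h
  refine (h.congr' ?_).trans (by simp)
  filter_upwards [hp.eventually_ge_atTop 1] with i hi
  have hpi : p i ≠ 0 := fun h0 => by simp [h0] at hi; linarith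
  rw [setAverage_logPotential hE hr0 hpi hf hf' hrep, add_div, mul_div_assoc, ← integral_div]
  simp_rw [mul_div_assoc]

/-- Jensen's inequality for the exponential on a ball. -/
lemma measureReal_mul_exp_setAverage_le {u : E → ℝ} (hu : Continuous u) (a : ℝ) (p : E) {ρ : ℝ}
    (hρ : 0 < ρ) :
    volume.real (Metric.ball p ρ) * Real.exp (a * ⨍ x in Metric.ball p ρ, u x) ≤
      ∫ x in Metric.ball p ρ, Real.exp (a * u x) := by
  have hBpos : 0 < volume.real (Metric.ball p ρ) :=
      measureReal_ball_pos hρ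
  have hcont : ∀ g : E → ℝ, Continuous g → IntegrableOn g (Metric.ball p ρ) := fun g hg =>
    (hg.continuousOn.integrableOn_compact (isCompact_closedBall p ρ)).mono_set
      Metric.ball_subset_closedBall
  set m := ⨍ x in Metric.ball p ρ, u x with hm
  have hm' : ∫ x in Metric.ball p ρ, u x = volume.real (Metric.ball p ρ) * m := by
    rw [hm, setAverage_eq, smul_eq_mul]
    field_simp
  -- The integrand is the tangent line of the exponential at the mean `m`; its linear part
  -- integrates to zero.
  have hlin : ∫ x in Metric.ball p ρ, Real.exp (a * m) * (1 + a * (u x - m)) =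
      volume.real (Metric.ball p ρ) * Real.exp (a * m) := by
    have h1 : ∀ x, Real.exp (a * m) * (1 + a * (u x - m)) =
        Real.exp (a * m) * (1 - a * m) + Real.exp (a * m) * a * u x := fun x => by ring
    simp_rw [h1]
    rw [integral_add (hcont _ (by fun_prop)) (hcont _ (by fun_prop)), setIntegral_const,
      integral_const_mul, hm', smul_eq_mul]
    ring
  rw [← hlin]
  refine integral_mono (hcont _ (by fun_prop)) (hcont _ (by fun_prop)) fun x => ?_
  have h2 := Real.add_one_le_exp (a * (u x - m))
  have h3 : Real.exp (a * u x) = Real.exp (a * m) * Real.exp (a * (u x - m)) := by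
    rw [← Real.exp_add]; ring_nf
  simp only [h3]
  gcongr
  linarith

/-- Integrability on a sequence of cones where `|Q|` grows like `|x|^s` forces a lower bound for
the total mass. -/
lemma add_finrank_le_of_cone (hE : 2 ≤ Module.finrank ℝ E) {Q u : E → ℝ} (hQ : Continuous Q)
    (hu : Continuous u) {a b C s : ℝ} (hs : 0 ≤ s)
    (hf : Integrable fun x => Q x * Real.exp (a * u x))
    (hrep : ∀ x, u x = b * (∫ y, Real.log (‖y‖ / ‖x - y‖) * (Q y * Real.exp (a * u y))) + C)
    {r : ℝ} (hr0 : 0 < r) (hr1 : r < 1) {p : ℕ → E}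
    (hp : Tendsto (fun i => ‖p i‖) atTop atTop) {c₁ : ℝ} (hc₁ : 0 < c₁)
    (hcone : ∀ i, ∀ x ∈ Metric.ball (p i) (r * ‖p i‖), c₁ ≤ |Q x| / ‖x‖ ^ s) :
    s + Module.finrank ℝ E ≤ a * (b * ∫ x, Q x * Real.exp (a * u x)) := by
  have : Nontrivial E := Module.nontrivial_of_finrank_pos (R := ℝ) (by omega)
  have hfc : Continuous fun x => Q x * Real.exp (a * u x) := by fun_prop
  have hT := tendsto_setAverage_logPotential hE hr0 hr1 hp hf
    (integrable_mul_inv_norm hE hfc hf) hrep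
  have hlog : Tendsto (fun i => Real.log ‖p i‖) atTop atTop := Real.tendsto_log_atTop.comp hp
  set N := ∫ x, |Q x * Real.exp (a * u x)| with hN
  set V := volume.real (Metric.ball (0 : E) 1) with hV
  have hVpos : 0 < V := measureReal_ball_pos one_pos
  set κ := c₁ * (1 - r) ^ s * (r ^ Module.finrank ℝ E * V) with hκ
  have hr1' : 0 < 1 - r := by linarith
  have hκpos : 0 < κ := by positivity
  -- This is the logarithm of `κ ‖p i‖ ^ (s + d) exp (a m) ≤ N`, with `d` the dimension and `m` the
  -- mean of `u`, divided by `log ‖p i‖`; the right side tends to `0`.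
  have hkey : ∀ᶠ i in atTop, (s + Module.finrank ℝ E) +
      a * ((⨍ x in Metric.ball (p i) (r * ‖p i‖), u x) / Real.log ‖p i‖) ≤
      (Real.log N - Real.log κ) / Real.log ‖p i‖ := by
    filter_upwards [hp.eventually_gt_atTop 1] with i hi
    have hpi : 0 < ‖p i‖ := by linarith
    have hl : 0 < Real.log ‖p i‖ := Real.log_pos hi
    have hρ : 0 < r * ‖p i‖ := by positivity
    have hBvol : volume.real (Metric.ball (p i) (r * ‖p i‖)) =
        (r * ‖p i‖) ^ Module.finrank ℝ E * V := by
      rw [measureReal_def, Measure.addHaar_ball _ _ hρ.le,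
          ENNReal.toReal_mul, ENNReal.toReal_ofReal (by positivity), ← measureReal_def]
    set m := ⨍ x in Metric.ball (p i) (r * ‖p i‖), u x with hm
    have hJ := measureReal_mul_exp_setAverage_le hu a (p i) hρ
    have hexp : IntegrableOn (fun x => Real.exp (a * u x)) (Metric.ball (p i) (r * ‖p i‖)) :=
      ((by fun_prop : Continuous fun x => Real.exp (a * u x)).continuousOn.integrableOn_compact
        (isCompact_closedBall (p i) _)).mono_set Metric.ball_subset_closedBall
    have hlow : ∫ x in Metric.ball (p i) (r * ‖p i‖),
        (c₁ * ((1 - r) * ‖p i‖) ^ s) * Real.exp (a * u x) ≤ N := by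
      refine (setIntegral_mono_on (hexp.const_mul _) hf.abs.integrableOn measurableSet_ball
        fun x hx => ?_).trans (setIntegral_le_integral hf.abs
          (ae_of_all _ fun x => abs_nonneg _))
      have hx1 := (norm_bounds_of_mem_ball hx).1
      have hx0 : 0 < ‖x‖ := lt_of_lt_of_le (by positivity) hx1
      have h1 := hcone i x hx
      rw [le_div_iff₀ (by positivity)] at h1
      rw [abs_mul, Real.abs_exp]
      gcongr
      refine le_trans ?_ h1
      gcongr
    rw [integral_const_mul] at hlow
    have hprod : κ * ‖p i‖ ^ (s + Module.finrank ℝ E) * Real.exp (a * m) ≤ N := by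
      refine le_trans (le_of_eq ?_) ((mul_le_mul_of_nonneg_left hJ (by positivity)).trans hlow)
      rw [hBvol, Real.rpow_add hpi, Real.rpow_natCast, Real.mul_rpow hr1'.le hpi.le, mul_pow, hκ]
      ring
    have hlogle := Real.log_le_log (by positivity) hprod
    rw [Real.log_mul (by positivity) (by positivity), Real.log_mul (by positivity)
      (by positivity), Real.log_exp, Real.log_rpow hpi] at hlogle
    rw [le_div_iff₀ hl, add_mul, mul_assoc a, div_mul_cancel₀ _ hl.ne']
    linarith
  have hlim := le_of_tendsto_of_tendsto ((hT.const_mul a).const_add (s + Module.finrank ℝ E))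
    (hlog.const_div_atTop (Real.log N - Real.log κ)) hkey
  linarith

end Averages

/-! ### Conclusion: the two mass bounds against cone growth -/

lemma sphereVolume_pos (n : ℕ) : 0 < sphereVolume n := by
  rw [sphereVolume, Measure.toSphere_real_apply_univ, finrank_euclideanSpace_fin]
  have : 0 < (volume : Measure (EuclideanSpace ℝ (Fin (n + 1)))).real (Metric.ball 0 1) :=
    measureReal_ball_pos one_pos
  positivity

/-- A function satisfying a cone condition of positive order is unbounded. -/
lemma SatisfiesCone.not_const {n : ℕ} {s : ℝ} {Q : EuclideanSpace ℝ (Fin n) → ℝ}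
    (h : SatisfiesCone s Q) (hs : 0 < s) (q : ℝ) : ¬ ∀ x, Q x = q := by
  intro hq
  obtain ⟨r, hr0, hr1, p, hp1, hp, c₁, hc₁, hcone⟩ := h.cone
  have hlim : Tendsto (fun i => |q| / ‖p i‖ ^ s) atTop (𝓝 0) :=
    ((tendsto_rpow_atTop hs).comp hp).const_div_atTop |q|
  refine absurd (ge_of_tendsto hlim (Eventually.of_forall fun i => ?_)) (not_le.2 hc₁)
  have h1 : 0 < ‖p i‖ := lt_of_lt_of_le one_pos (hp1 i)
  simpa [hq] using hcone i (p i) (Metric.mem_ball_self (mul_pos hr0 h1))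

theorem mainTheorem8 (n : ℕ) (hn : 2 ≤ n) (hne : Even n) (s : ℝ) (hs : (n : ℝ) ≤ s)
    (Q : EuclideanSpace ℝ (Fin n) → ℝ) (hQ : ContDiff ℝ ∞ Q)
    (hcone : SatisfiesCone s Q)
    (hrad : ∀ x : EuclideanSpace ℝ (Fin n), inner ℝ x (gradient Q x) ≤ 0) :
    ¬ ∃ u : EuclideanSpace ℝ (Fin n) → ℝ, ContDiff ℝ ∞ u ∧
      Integrable (fun x => Q x * Real.exp (n * u x)) volume ∧
      IsNormalSolution n Q u := by
  rintro ⟨u, hu, hf, C, hrep⟩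
  have hE : Module.finrank ℝ (EuclideanSpace ℝ (Fin n)) = n := finrank_euclideanSpace_fin
  have hE2 : 2 ≤ Module.finrank ℝ (EuclideanSpace ℝ (Fin n)) := hE.symm ▸ hn
  have hn0 : (0 : ℝ) < n := by exact_mod_cast (by omega : 0 < n)
  have hQ1 : ContDiff ℝ 1 Q := hQ.of_le (by exact_mod_cast le_top)
  have hu1 : ContDiff ℝ 1 u := hu.of_le (by exact_mod_cast le_top)
  have hrad' : ∀ x, fderiv ℝ Q x x ≤ 0 := fun x => by
    have h := hrad x
    rwa [real_inner_comm, inner_gradient_left] at h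
  set b : ℝ := 2 / (((n - 1)! : ℕ) * sphereVolume n) with hb
  have hbpos : 0 < b := by
    have := sphereVolume_pos n
    have h2 : (0 : ℝ) < ((n - 1)! : ℕ) := by exact_mod_cast Nat.factorial_pos _
    positivity
  obtain ⟨hle, heq⟩ := pohozaev_of_fderiv_nonpos hE2 hQ1 hu1 hf hrep hrad'
  obtain ⟨r, hr0, hr1, p, -, hp, c₁, hc₁, hc⟩ := hcone.cone
  have hge := add_finrank_le_of_cone hE2 hQ.continuous hu.continuous (hn0.le.trans hs) hf hrep
    hr0 hr1 hp hc₁ hc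
  set F := ∫ x, Q x * Real.exp (n * u x) with hF
  rw [hE] at hle heq hge
  -- From `2n ≤ s + n ≤ n b F`. It makes `F` positive and reverses the Pohozaev inequality.
  have hα : 2 ≤ b * F := by nlinarith
  have hFpos : 0 < F := pos_of_mul_pos_right (by linarith) hbpos.le
  have hconst := heq (le_antisymm hle (by nlinarith [mul_pos hn0 hFpos]))
  exact hcone.not_const (hn0.trans_le hs) (Q 0)
    (eq_apply_zero_of_fderiv_apply_self_eq_zero (hQ1.differentiable one_ne_zero) hconst)
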